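/- Let $a<b$ be real numbers and let $H_+^{AC}=H_+^{AC}([a,b])$ be the group, under composition, of all increasing homeomorphisms $f:[a,b]\to[a,b]$ such that both $f$ and $f^{-1}$ are absolutely continuous, with the topology of the metric $\rho(f,g)=\int_a^b|f'-g'|\,d\lambda$, where $\lambda$ is Lebesgue measure. For a Polish group $G$ and $n\in\mathbb{N}$ let $\Omega_n\subseteq G^n$ be the set of $n$-tuples that generate a dense subgroup of $G$. Call $G$ topologically $n$-generated if $\Omega_n\neq\emptyset$, and generically $n$-generated if $\Omega_n$ is comeagre in $G^n$ with the product topology; the least such $n$ is the topological rank, respectively the generic rank, of $G$ (with value $\aleph_0$ if no such finite $n$ exists). Then $H_+^{AC}$ is a Polish group, and it is generically $2$-generated: the set of pairs $(f,g)\in H_+^{AC}\times H_+^{AC}$ for which $\langle f,g\rangle$ is dense in $H_+^{AC}$ is a dense $G_\delta$ set, and so comeagre. Moreover $H_+^{AC}$ is not topologically $1$-generated, and its topological rank and its generic rank are both equal to $2$. -/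

import Mathlib

open Set MeasureTheory Topology

noncomputable section

/-- The self-map of `ℝ` that is `f` on `[a, b]` and the identity outside `[a, b]`. It only serves to
speak of the derivative and of the absolute continuity of `f : [a, b] → ℝ`. -/
def extendId {a b : ℝ} (f : Icc a b ≃ₜ Icc a b) (x : ℝ) : ℝ :=
  if hx : x ∈ Icc a b then (f ⟨x, hx⟩ : ℝ) else x

lemma extendId_of_mem {a b : ℝ} (f : Icc a b ≃ₜ Icc a b) {x : ℝ} (hx : x ∈ Icc a b) :
    extendId f x = f ⟨x, hx⟩ := dif_pos hx

lemma extendId_of_notMem {a b : ℝ} (f : Icc a b ≃ₜ Icc a b) {x : ℝ} (hx : x ∉ Icc a b) :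
    extendId f x = x := dif_neg hx

lemma extendId_mul {a b : ℝ} (f g : Icc a b ≃ₜ Icc a b) :
    extendId (f * g) = extendId f ∘ extendId g := by
  funext x
  by_cases hx : x ∈ Icc a b
  · simp only [Function.comp, extendId_of_mem _ hx, extendId_of_mem f (g ⟨x, hx⟩).2]
    rfl
  · simp only [Function.comp, extendId_of_notMem _ hx]

lemma extendId_one {a b : ℝ} : extendId (1 : Icc a b ≃ₜ Icc a b) = id := by
  funext x
  by_cases hx : x ∈ Icc a b
  · rw [extendId_of_mem _ hx]; rfl
  · rw [extendId_of_notMem _ hx]; rfl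

lemma extendId_mem_uIcc {a b : ℝ} (f : Icc a b ≃ₜ Icc a b) {x : ℝ} (hx : x ∈ uIcc a b) :
    extendId f x ∈ uIcc a b := by
  by_cases h : x ∈ Icc a b
  · rw [extendId_of_mem f h]; exact Icc_subset_uIcc (f ⟨x, h⟩).2
  · rwa [extendId_of_notMem f h]

lemma extendId_monotone {a b : ℝ} {f : Icc a b ≃ₜ Icc a b} (hf : StrictMono f) :
    Monotone (extendId f) := by
  intro x y hxy
  by_cases hx : x ∈ Icc a b <;> by_cases hy : y ∈ Icc a b
  · rw [extendId_of_mem f hx, extendId_of_mem f hy]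
    exact hf.monotone (show (⟨x, hx⟩ : Icc a b) ≤ ⟨y, hy⟩ from hxy)
  · rw [extendId_of_mem f hx, extendId_of_notMem f hy]
    have h1 := (f ⟨x, hx⟩).2
    simp only [mem_Icc, not_and, not_le] at hx hy h1
    have := hy (hx.1.trans hxy)
    linarith
  · rw [extendId_of_notMem f hx, extendId_of_mem f hy]
    have h1 := (f ⟨y, hy⟩).2
    simp only [mem_Icc, not_and, not_le] at hx hy h1
    by_contra! h
    have := hx (h1.1.trans h.le)
    linarith
  · rwa [extendId_of_notMem f hx, extendId_of_notMem f hy]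

lemma absolutelyContinuous_extendId_mul {a b : ℝ} {f g : Icc a b ≃ₜ Icc a b} (hg : StrictMono g)
    (hF : AbsolutelyContinuousOnInterval (extendId f) a b)
    (hG : AbsolutelyContinuousOnInterval (extendId g) a b) :
    AbsolutelyContinuousOnInterval (extendId (f * g)) a b := by
  rw [extendId_mul]
  rw [absolutelyContinuousOnInterval_iff] at hF hG ⊢
  intro ε hε
  obtain ⟨δ₁, hδ₁, h₁⟩ := hF ε hε
  obtain ⟨δ, hδ, h₂⟩ := hG δ₁ hδ₁
  refine ⟨δ, hδ, fun E hE hlen => ?_⟩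
  refine h₁ (E.1, fun i => (extendId g (E.2 i).1, extendId g (E.2 i).2)) ⟨?_, ?_⟩ (h₂ E hE hlen)
  · intro i hi
    exact ⟨extendId_mem_uIcc g (hE.1 i hi).1, extendId_mem_uIcc g (hE.1 i hi).2⟩
  · intro i hi j hj hij
    have h := hE.2 hi hj hij
    have hm := extendId_monotone hg
    simp only [Function.onFun, uIoc, Ioc_disjoint_Ioc] at h ⊢
    simp only [← hm.map_min, ← hm.map_max]
    exact hm h

/-- The group of increasing self-homeomorphisms `f` of `[a, b]` such that `f` and `f⁻¹` are
absolutely continuous, as a subgroup of the group of all self-homeomorphisms. -/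
def hPlusACSubgroup (a b : ℝ) : Subgroup (Icc a b ≃ₜ Icc a b) where
  carrier := {f | StrictMono f ∧ AbsolutelyContinuousOnInterval (extendId f) a b ∧
    AbsolutelyContinuousOnInterval (extendId f⁻¹) a b}
  one_mem' := by
    have h : AbsolutelyContinuousOnInterval (extendId (1 : Icc a b ≃ₜ Icc a b)) a b := by
      rw [extendId_one]
      exact (LipschitzWith.id.lipschitzOnWith (s := uIcc a b)).absolutelyContinuousOnInterval
    exact ⟨strictMono_id, h, by rwa [inv_one]⟩
  mul_mem' := by
    rintro f g ⟨hf, hf₁, hf₂⟩ ⟨hg, hg₁, hg₂⟩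
    refine ⟨hf.comp hg, absolutelyContinuous_extendId_mul hg hf₁ hg₁, ?_⟩
    rw [mul_inv_rev]
    refine absolutelyContinuous_extendId_mul (fun x y hxy => ?_) hg₂ hf₂
    refine hf.lt_iff_lt.1 ?_
    rwa [show f (f⁻¹ x) = x from f.apply_symm_apply x,
      show f (f⁻¹ y) = y from f.apply_symm_apply y]
  inv_mem' := by
    rintro f ⟨hf, hf₁, hf₂⟩
    refine ⟨fun x y hxy => hf.lt_iff_lt.1 ?_, hf₂, by rwa [inv_inv]⟩
    rwa [show f (f⁻¹ x) = x from f.apply_symm_apply x,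
      show f (f⁻¹ y) = y from f.apply_symm_apply y]

/-- The group `H₊^AC([a, b])`. It is a type of its own, so that it carries no topology other than
the one of the metric `ρ` below. -/
def HPlusAC (a b : ℝ) : Type := hPlusACSubgroup a b

namespace HPlusAC

variable {a b : ℝ}

instance : Group (HPlusAC a b) := inferInstanceAs (Group (hPlusACSubgroup a b))

/-- The underlying homeomorphism of `[a, b]`. -/
def toHomeo (f : HPlusAC a b) : Icc a b ≃ₜ Icc a b := Subtype.val f

/-- The metric `ρ(f, g) = ∫_a^b |f' - g'|`. -/
def rho (f g : HPlusAC a b) : ℝ :=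
  ∫ x in Icc a b, |deriv (extendId f.toHomeo) x - deriv (extendId g.toHomeo) x|

lemma integrableOn_deriv (f : HPlusAC a b) :
    IntegrableOn (deriv (extendId f.toHomeo)) (Icc a b) := by
  rcases le_or_gt a b with hab | hab
  · have h := f.2.2.1.intervalIntegrable_deriv
    rwa [intervalIntegrable_iff_integrableOn_Icc_of_le hab] at h
  · rw [Icc_eq_empty hab.not_ge]; exact integrableOn_empty

lemma extendId_left (f : HPlusAC a b) : extendId f.toHomeo a = a := by
  by_cases ha : a ∈ Icc a b
  · rw [extendId_of_mem _ ha]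
    obtain ⟨z, hz⟩ := f.toHomeo.surjective ⟨a, ha⟩
    have h : f.toHomeo ⟨a, ha⟩ ≤ f.toHomeo z :=
      f.2.1.monotone (show (⟨a, ha⟩ : Icc a b) ≤ z from z.2.1)
    rw [hz] at h
    exact le_antisymm h (f.toHomeo ⟨a, ha⟩).2.1
  · exact extendId_of_notMem _ ha

lemma eq_of_rho_eq_zero {f g : HPlusAC a b} (h : rho f g = 0) : f = g := by
  have hae : ∀ᵐ x, x ∈ Icc a b →
      deriv (extendId f.toHomeo) x = deriv (extendId g.toHomeo) x := by
    have h' := (integral_eq_zero_iff_of_nonneg (fun _ => abs_nonneg _)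
      ((integrableOn_deriv f).sub (integrableOn_deriv g)).abs).1 h
    filter_upwards [(ae_restrict_iff' measurableSet_Icc).1 h'] with x hx hxm
    exact sub_eq_zero.1 (abs_eq_zero.1 (hx hxm))
  refine Subtype.ext (Homeomorph.ext fun x => Subtype.ext ?_)
  have hab : a ≤ b := x.2.1.trans x.2.2
  have hsub : uIcc a (x : ℝ) ⊆ uIcc a b := by
    rw [uIcc_of_le hab, uIcc_of_le x.2.1]; exact Icc_subset_Icc_right x.2.2
  have hf := (f.2.2.1.mono hsub).integral_deriv_eq_sub
  have hg := (g.2.2.1.mono hsub).integral_deriv_eq_sub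
  have hi : ∫ t in a..(x : ℝ), deriv (extendId f.toHomeo) t =
      ∫ t in a..(x : ℝ), deriv (extendId g.toHomeo) t := by
    refine intervalIntegral.integral_congr_ae ?_
    filter_upwards [hae] with t ht htm
    rw [uIoc_of_le x.2.1] at htm
    exact ht ⟨htm.1.le, htm.2.trans x.2.2⟩
  have hfa := extendId_left f
  have hga := extendId_left g
  have hfx : extendId f.toHomeo x = f.toHomeo x := extendId_of_mem _ x.2
  have hgx : extendId g.toHomeo x = g.toHomeo x := extendId_of_mem _ x.2
  change (f.toHomeo x : ℝ) = g.toHomeo x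
  change _ = extendId f.toHomeo x - extendId f.toHomeo a at hf
  change _ = extendId g.toHomeo x - extendId g.toHomeo a at hg
  change ∫ t in a..(x : ℝ), deriv (extendId f.toHomeo) t = _ at hf
  change ∫ t in a..(x : ℝ), deriv (extendId g.toHomeo) t = _ at hg
  linarith

/-- The topology of `H₊^AC([a, b])` is the one of the metric `ρ`. -/
instance : MetricSpace (HPlusAC a b) where
  dist := rho
  dist_self f := by simp [rho]
  dist_comm f g := by simp only [rho, abs_sub_comm]
  dist_triangle f g h := by
    have hf := integrableOn_deriv f
    have hg := integrableOn_deriv g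
    have hh := integrableOn_deriv h
    refine le_trans (integral_mono (hf.sub hh).abs ((hf.sub hg).abs.add (hg.sub hh).abs)
      fun x => abs_sub_le _ (deriv (extendId g.toHomeo) x) _)
      (integral_add (hf.sub hg).abs (hg.sub hh).abs).le
  eq_of_dist_eq_zero := eq_of_rho_eq_zero

end HPlusAC

/-- The set `Ω_n` of the `n`-tuples that generate a dense subgroup of `G`. -/
def denseGenerators (G : Type*) [Group G] [TopologicalSpace G] (n : ℕ) : Set (Fin n → G) :=
  {g | Dense (Subgroup.closure (range g) : Set G)}

/-- `G` has a dense subgroup generated by `n` elements. -/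
def IsTopologicallyGenerated (G : Type*) [Group G] [TopologicalSpace G] (n : ℕ) : Prop :=
  (denseGenerators G n).Nonempty

/-- The `n`-tuples that generate a dense subgroup form a comeagre subset of `G ^ n`. -/
def IsGenericallyGenerated (G : Type*) [Group G] [TopologicalSpace G] (n : ℕ) : Prop :=
  denseGenerators G n ∈ residual (Fin n → G)

/-- The least `n` such that `G` is topologically `n`-generated. The value `⊤` (no finite `n`)
stands for `ℵ₀`, as every Polish group is topologically `ℵ₀`-generated. -/
def topologicalRank (G : Type*) [Group G] [TopologicalSpace G] : ℕ∞ :=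
  ⨅ (n : ℕ) (_ : IsTopologicallyGenerated G n), (n : ℕ∞)

/-- The least `n` such that `G` is generically `n`-generated. The value `⊤` (no finite `n`)
stands for `ℵ₀`, as every Polish group is generically `ℵ₀`-generated. -/
def genericRank (G : Type*) [Group G] [TopologicalSpace G] : ℕ∞ :=
  ⨅ (n : ℕ) (_ : IsGenericallyGenerated G n), (n : ℕ∞)

end

open Filter

/-!
Since the total variation of `f - g` is `∫ |f' - g'|`, the metric is invariant under right
translations. Left translations by `C¹` diffeomorphisms are continuous, and these are dense, so all
left translations are continuous and the group is topological. The map `f ↦ (f', (f⁻¹)')` is a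
closed embedding into `L¹ × L¹`, so the group is Polish.

By the Baire category theorem it remains to change a given pair `(f, g)` slightly so that it
generates an element near a given `h`. First, `f` and `g` are replaced by `C¹` diffeomorphisms and
perturbed by `s (x - a) (b - x)` and `t (x - a) (b - x)`; as the common fixed points sit over a `C¹`
curve in the `(s, t)`-plane, almost every choice leaves none in `(a, b)`. Then `f`, say, is changed
near `a` so that it has no fixed point in some `(a, r]`. Now `⟨f, g⟩` moves any point of `(a, b)`
below `r`, and the powers of `f` move it on towards `a`, so some `k ∈ ⟨f, g⟩` maps a compact part of
`(a, b)` as close to `a` as desired. There `g` is replaced by `k h k⁻¹`, at small cost: only the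
derivative of `g` on a short interval changes. If that interval is short enough, the word `k` in the
new pair still acts in the same way on the compact part, and the conjugate `k⁻¹ g k` agrees with `h`
there.

Conversely, a Hausdorff group with a dense cyclic subgroup is commutative, and this one is not.
-/

theorem absolutelyContinuousOnInterval_congr {X : Type*} [PseudoMetricSpace X] {u v : ℝ → X}
    {a b : ℝ} (h : EqOn u v (uIcc a b)) :
    AbsolutelyContinuousOnInterval u a b ↔ AbsolutelyContinuousOnInterval v a b := by
  simp only [absolutelyContinuousOnInterval_iff]
  refine forall₂_congr fun ε _ => exists_congr fun δ => and_congr_right fun _ =>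
    forall₂_congr fun E hE => ?_
  have hsum : ∑ i ∈ Finset.range E.1, dist (u (E.2 i).1) (u (E.2 i).2) =
      ∑ i ∈ Finset.range E.1, dist (v (E.2 i).1) (v (E.2 i).2) :=
    Finset.sum_congr rfl fun i hi => by rw [h (hE.1 i hi).1, h (hE.1 i hi).2]
  rw [hsum]

theorem absolutelyContinuousOnInterval_comp_monotoneOn {X : Type*} [PseudoMetricSpace X]
    {u : ℝ → X} {θ : ℝ → ℝ} {a b c d : ℝ} (hu : AbsolutelyContinuousOnInterval u c d)
    (hθ : AbsolutelyContinuousOnInterval θ a b) (hmono : MonotoneOn θ (uIcc a b))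
    (hmaps : MapsTo θ (uIcc a b) (uIcc c d)) :
    AbsolutelyContinuousOnInterval (u ∘ θ) a b := by
  rw [absolutelyContinuousOnInterval_iff] at hu hθ ⊢
  intro ε hε
  obtain ⟨η, hη, hu⟩ := hu ε hε
  obtain ⟨δ, hδ, hθ⟩ := hθ η hη
  refine ⟨δ, hδ, fun E hE hlen =>
    hu (E.1, fun i => (θ (E.2 i).1, θ (E.2 i).2)) ⟨fun i hi => ?_, fun i hi j hj hij => ?_⟩
      (hθ E hE hlen)⟩
  · exact ⟨hmaps (hE.1 i hi).1, hmaps (hE.1 i hi).2⟩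
  · obtain ⟨hi₁, hi₂⟩ := hE.1 i hi
    obtain ⟨hj₁, hj₂⟩ := hE.1 j hj
    have hdisj := hE.2 hi hj hij
    simp only [Function.onFun, uIoc, Ioc_disjoint_Ioc] at hdisj ⊢
    rw [← hmono.map_min hi₁ hi₂, ← hmono.map_min hj₁ hj₂, ← hmono.map_max hi₁ hi₂,
      ← hmono.map_max hj₁ hj₂]
    have hmax {x y : ℝ} (hx : x ∈ uIcc a b) (hy : y ∈ uIcc a b) : max x y ∈ uIcc a b :=
      max_rec' (· ∈ uIcc a b) hx hy
    have hmin {x y : ℝ} (hx : x ∈ uIcc a b) (hy : y ∈ uIcc a b) : min x y ∈ uIcc a b :=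
      min_rec' (· ∈ uIcc a b) hx hy
    rw [← hmono.map_min (hmax hi₁ hi₂) (hmax hj₁ hj₂),
      ← hmono.map_max (hmin hi₁ hi₂) (hmin hj₁ hj₂)]
    exact hmono (hmin (hmax hi₁ hi₂) (hmax hj₁ hj₂)) (hmax (hmin hi₁ hi₂) (hmin hj₁ hj₂)) hdisj

theorem absolutelyContinuousOnInterval_min_add_max {u : ℝ → ℝ} {a b p : ℝ}
    (hu : AbsolutelyContinuousOnInterval u a b) (hp : p ∈ Icc a b) :
    AbsolutelyContinuousOnInterval (fun x => u (min x p) + (max x p - p)) a b := by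
  have hmin : AbsolutelyContinuousOnInterval (fun x : ℝ => min x p) a b :=
    (LipschitzWith.id.min_const p).lipschitzOnWith.absolutelyContinuousOnInterval
  have hmax : AbsolutelyContinuousOnInterval (fun x : ℝ => max x p - p) a b :=
    ((LipschitzWith.id.max_const p).sub (LipschitzWith.const p))
      |>.lipschitzOnWith.absolutelyContinuousOnInterval
  refine (absolutelyContinuousOnInterval_comp_monotoneOn hu hmin
    (fun x _ y _ hxy => min_le_min_right p hxy) ?_).add hmax
  rw [uIcc_of_le (hp.1.trans hp.2)]
  exact fun x hx => ⟨le_min hx.1 hp.1, (min_le_left _ _).trans hx.2⟩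

theorem eVariationOn_le_of_edist_le {α E F : Type*} [LinearOrder α] [PseudoEMetricSpace E]
    [PseudoEMetricSpace F] {f : α → E} {g : α → F} {s : Set α}
    (h : ∀ x ∈ s, ∀ y ∈ s, x ≤ y → edist (f x) (f y) ≤ edist (g x) (g y)) :
    eVariationOn f s ≤ eVariationOn g s := by
  refine iSup_mono fun p => Finset.sum_le_sum fun i _ => ?_
  rw [edist_comm, edist_comm (g _)]
  exact h _ (p.2.2.2 _) _ (p.2.2.2 _) (p.2.2.1 i.le_succ)

theorem abs_deriv_le_deriv_of_abs_sub_le {v P : ℝ → ℝ} {s : Set ℝ} {x : ℝ} (hs : s ∈ 𝓝 x)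
    (hP : DifferentiableAt ℝ P x)
    (h : ∀ y ∈ s, ∀ z ∈ s, y ≤ z → |v z - v y| ≤ P z - P y) : |deriv v x| ≤ deriv P x := by
  have hx := mem_of_mem_nhds hs
  have hslope : ∀ᶠ y in 𝓝[≠] x, |slope v x y| ≤ slope P x y := by
    filter_upwards [mem_nhdsWithin_of_mem_nhds hs, self_mem_nhdsWithin] with y hy hne
    rcases lt_or_gt_of_ne hne with hlt | hlt
    · rw [slope_comm v, slope_comm P, slope_def_field, slope_def_field, abs_div,
        abs_of_pos (sub_pos.2 hlt)]
      gcongr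
      exact h y hy x hx hlt.le
    · rw [slope_def_field, slope_def_field, abs_div, abs_of_pos (sub_pos.2 hlt)]
      gcongr
      exact h x hx y hy hlt.le
  have hP' := hasDerivAt_iff_tendsto_slope.1 hP.hasDerivAt
  by_cases hv : DifferentiableAt ℝ v x
  · exact le_of_tendsto_of_tendsto (hasDerivAt_iff_tendsto_slope.1 hv.hasDerivAt).abs hP' hslope
  · rw [deriv_zero_of_not_differentiableAt hv, abs_zero]
    exact ge_of_tendsto hP' (hslope.mono fun y hy => (abs_nonneg _).trans hy)

theorem integral_abs_deriv_le_of_abs_sub_le {v P : ℝ → ℝ} {a b : ℝ} (hab : a ≤ b)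
    (h : ∀ x ∈ Icc a b, ∀ y ∈ Icc a b, x ≤ y → |v y - v x| ≤ P y - P x) :
    ∫ x in Icc a b, |deriv v x| ≤ P b - P a := by
  have hP : MonotoneOn P (Icc a b) := fun x hx y hy hxy =>
    sub_nonneg.1 ((abs_nonneg _).trans (h x hx y hy hxy))
  have hPu : MonotoneOn P (uIcc a b) := by rwa [uIcc_of_le hab]
  have hderiv : ∀ᵐ x ∂volume.restrict (Icc a b), |deriv v x| ≤ deriv P x := by
    rw [← restrict_Ioo_eq_restrict_Icc, ae_restrict_iff' measurableSet_Ioo]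
    filter_upwards [hP.ae_differentiableWithinAt_of_mem] with x hx hmem
    have hs : Icc a b ∈ 𝓝 x := Icc_mem_nhds hmem.1 hmem.2
    exact abs_deriv_le_deriv_of_abs_sub_le hs
      ((hx (Ioo_subset_Icc_self hmem)).differentiableAt hs) h
  calc ∫ x in Icc a b, |deriv v x|
      ≤ ∫ x in Icc a b, deriv P x :=
        integral_mono_of_nonneg (ae_of_all _ fun _ => abs_nonneg _)
          ((intervalIntegrable_iff_integrableOn_Icc_of_le hab).1 hPu.intervalIntegrable_deriv)
          hderiv
    _ = ∫ x in a..b, deriv P x := by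
        rw [integral_Icc_eq_integral_Ioc, intervalIntegral.integral_of_le hab]
    _ ≤ P b - P a := by
        have hmem := hPu.intervalIntegral_deriv_mem_uIcc
        rw [uIcc_of_le (sub_nonneg.2 (hP (left_mem_Icc.2 hab) (right_mem_Icc.2 hab) hab))] at hmem
        exact hmem.2

theorem integral_abs_deriv_le_eVariationOn {v : ℝ → ℝ} {a b : ℝ} (hab : a ≤ b)
    (hv : BoundedVariationOn v (Icc a b)) :
    ∫ x in Icc a b, |deriv v x| ≤ (eVariationOn v (Icc a b)).toReal := by
  have ha := left_mem_Icc.2 hab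
  have hv' := hv.locallyBoundedVariationOn
  have hdom : ∀ x ∈ Icc a b, ∀ y ∈ Icc a b, x ≤ y → |v y - v x| ≤
      variationOnFromTo v (Icc a b) a y - variationOnFromTo v (Icc a b) a x := by
    intro x hx y hy hxy
    rw [variationOnFromTo.sub_right hv' ha hy hx, variationOnFromTo.eq_of_le _ _ hxy,
      ← Real.dist_eq, dist_edist]
    exact ENNReal.toReal_mono (hv' x y hx hy)
      (eVariationOn.edist_le v ⟨hy, hxy, le_rfl⟩ ⟨hx, le_rfl, hxy⟩)
  calc ∫ x in Icc a b, |deriv v x|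
      ≤ variationOnFromTo v (Icc a b) a b - variationOnFromTo v (Icc a b) a a :=
        integral_abs_deriv_le_of_abs_sub_le hab hdom
    _ = (eVariationOn v (Icc a b)).toReal := by
        rw [variationOnFromTo.self, sub_zero, variationOnFromTo.eq_of_le _ _ hab, inter_self]

theorem eVariationOn_le_integral_abs_deriv {v : ℝ → ℝ} {a b : ℝ} (hab : a ≤ b)
    (hv : AbsolutelyContinuousOnInterval v a b) :
    eVariationOn v (Icc a b) ≤ ENNReal.ofReal (∫ x in Icc a b, |deriv v x|) := by
  have hint : ∀ x ∈ Icc a b, ∀ y ∈ Icc a b,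
      IntervalIntegrable (fun t => |deriv v t|) volume x y := fun x hx y hy =>
    hv.intervalIntegrable_deriv.abs.mono_set
      (by rw [uIcc_of_le hab]; exact uIcc_subset_Icc hx hy)
  set P : ℝ → ℝ := fun x => ∫ t in a..x, |deriv v t|
  have ha := left_mem_Icc.2 hab
  have hPsub : ∀ x ∈ Icc a b, ∀ y ∈ Icc a b, P y - P x = ∫ t in x..y, |deriv v t| :=
    fun x hx y hy => intervalIntegral.integral_interval_sub_left (hint a ha y hy) (hint a ha x hx)
  have hdom : ∀ x ∈ Icc a b, ∀ y ∈ Icc a b, x ≤ y → |v y - v x| ≤ P y - P x := by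
    intro x hx y hy hxy
    rw [hPsub x hx y hy, ← (hv.mono (by
      rw [uIcc_of_le hab]; exact uIcc_subset_Icc hx hy)).integral_deriv_eq_sub]
    exact intervalIntegral.abs_integral_le_integral_abs hxy
  have hPmono : MonotoneOn P (Icc a b) := fun x hx y hy hxy =>
    sub_nonneg.1 ((abs_nonneg _).trans (hdom x hx y hy hxy))
  calc eVariationOn v (Icc a b)
      ≤ eVariationOn P (Icc a b) := eVariationOn_le_of_edist_le fun x hx y hy hxy => by
        rw [edist_dist, edist_dist, Real.dist_eq, Real.dist_eq, abs_sub_comm, abs_sub_comm (P x)]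
        exact ENNReal.ofReal_le_ofReal ((hdom x hx y hy hxy).trans (le_abs_self _))
    _ = ENNReal.ofReal (P b - P a) := by
        simpa only [inter_self] using hPmono.eVariationOn_eq ha (right_mem_Icc.2 hab)
    _ = ENNReal.ofReal (∫ x in Icc a b, |deriv v x|) := by
        rw [hPsub a ha b (right_mem_Icc.2 hab), integral_Icc_eq_integral_Ioc,
          intervalIntegral.integral_of_le hab]

theorem integral_abs_deriv_eq_eVariationOn {v : ℝ → ℝ} {a b : ℝ} (hab : a ≤ b)
    (hv : AbsolutelyContinuousOnInterval v a b) :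
    ∫ x in Icc a b, |deriv v x| = (eVariationOn v (Icc a b)).toReal := by
  refine le_antisymm (integral_abs_deriv_le_eVariationOn hab ?_)
    (ENNReal.toReal_le_of_le_ofReal (integral_nonneg fun _ => abs_nonneg _)
      (eVariationOn_le_integral_abs_deriv hab hv))
  simpa only [uIcc_of_le hab] using hv.boundedVariationOn

theorem dense_compl_image_of_contDiffOn_real {E : Type*} [NormedAddCommGroup E] [NormedSpace ℝ E]
    [FiniteDimensional ℝ E] (hE : 1 < Module.finrank ℝ E) {c : ℝ → E} {s : Set ℝ}
    (hc : ContDiffOn ℝ 1 c s) (hs : Convex ℝ s) : Dense (c '' s)ᶜ :=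
  hc.dense_compl_image_of_dimH_lt_finrank hs subset_rfl
    ((dimH_mono (subset_univ s)).trans_lt (by rw [Real.dimH_univ]; exact_mod_cast hE))

section L1Approximation

variable {X : Type*} [TopologicalSpace X] [NormalSpace X] [MeasurableSpace X] [BorelSpace X]
  {μ : Measure X} [IsFiniteMeasure μ] [μ.WeaklyRegular] {u : X → ℝ}

theorem exists_continuous_pos_integral_abs_sub_le (hu : Integrable u μ) (hnonneg : 0 ≤ᵐ[μ] u)
    {ε : ℝ} (hε : 0 < ε) :
    ∃ φ : X → ℝ, Continuous φ ∧ (∀ x, 0 < φ x) ∧ Integrable φ μ ∧ ∫ x, |u x - φ x| ∂μ ≤ ε := by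
  obtain ⟨ψ, hψ, hψi⟩ := hu.exists_boundedContinuous_integral_sub_le (half_pos hε)
  set τ : ℝ := ε / 2 / (μ.real univ + 1) with hτ
  have hμ : 0 < μ.real univ + 1 := by positivity
  have hτpos : 0 < τ := by positivity
  have hsub : Integrable (fun x => ‖u x - ψ x‖) μ := (hu.sub hψi).norm
  have hφi : Integrable (fun x => |ψ x| + τ) μ := hψi.abs.add (integrable_const τ)
  refine ⟨fun x => |ψ x| + τ, by fun_prop, fun x => by positivity, hφi, ?_⟩
  calc ∫ x, |u x - (|ψ x| + τ)| ∂μ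
      ≤ ∫ x, (‖u x - ψ x‖ + τ) ∂μ := by
        refine integral_mono_ae (hu.sub hφi).abs (hsub.add (integrable_const τ)) ?_
        filter_upwards [hnonneg] with x hx
        have habs := abs_abs_sub_abs_le_abs_sub (u x) (ψ x)
        rw [abs_of_nonneg hx] at habs
        rw [Real.norm_eq_abs, ← sub_sub]
        exact (abs_sub _ τ).trans (add_le_add habs (abs_of_pos hτpos).le)
    _ = ∫ x, ‖u x - ψ x‖ ∂μ + μ.real univ * τ := by
        rw [integral_add hsub (integrable_const τ), integral_const, smul_eq_mul]
    _ ≤ ε / 2 + ε / 2 := by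
        refine add_le_add hψ ?_
        rw [hτ, mul_div_assoc', div_le_iff₀ hμ]
        nlinarith
    _ = ε := add_halves ε

theorem exists_continuous_pos_integral_eq_integral_abs_sub_le (hu : Integrable u μ)
    (hnonneg : 0 ≤ᵐ[μ] u) (hpos : 0 < ∫ x, u x ∂μ) {ε : ℝ} (hε : 0 < ε) :
    ∃ φ : X → ℝ, Continuous φ ∧ (∀ x, 0 < φ x) ∧ Integrable φ μ ∧
      ∫ x, φ x ∂μ = ∫ x, u x ∂μ ∧ ∫ x, |u x - φ x| ∂μ ≤ ε := by
  obtain ⟨ψ, hψc, hψpos, hψi, hψ⟩ := exists_continuous_pos_integral_abs_sub_le hu hnonneg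
    (lt_min (half_pos hε) (half_pos hpos))
  set I := ∫ x, u x ∂μ
  set J := ∫ x, ψ x ∂μ
  have hIJ : |J - I| ≤ ∫ x, |u x - ψ x| ∂μ := by
    rw [abs_sub_comm, ← integral_sub hu hψi]
    exact abs_integral_le_integral_abs
  have hJ : 0 < J := by
    have := (abs_le.1 (hIJ.trans (hψ.trans (min_le_right _ _)))).1
    linarith
  have hsub : Integrable (fun x => |u x - ψ x|) μ := (hu.sub hψi).abs
  have hφi : Integrable (fun x => I / J * ψ x) μ := hψi.const_mul _
  refine ⟨fun x => I / J * ψ x, by fun_prop, fun x => mul_pos (div_pos hpos hJ) (hψpos x), hφi,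
    by rw [integral_const_mul, div_mul_cancel₀ _ hJ.ne'], ?_⟩
  have hscale : |1 - I / J| * J = |J - I| := by
    rw [one_sub_div hJ.ne', abs_div, abs_of_pos hJ, div_mul_cancel₀ _ hJ.ne']
  calc ∫ x, |u x - I / J * ψ x| ∂μ
      ≤ ∫ x, (|u x - ψ x| + |1 - I / J| * ψ x) ∂μ := by
        refine integral_mono (hu.sub hφi).abs (hsub.add (hψi.const_mul _)) fun x => ?_
        dsimp only
        rw [show u x - I / J * ψ x = (u x - ψ x) + (1 - I / J) * ψ x by ring]
        refine (abs_add_le _ _).trans_eq ?_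
        rw [abs_mul, abs_of_pos (hψpos x)]
    _ = ∫ x, |u x - ψ x| ∂μ + |J - I| := by
        rw [integral_add hsub (hψi.const_mul _), integral_const_mul, hscale]
    _ ≤ ε / 2 + ε / 2 := by
        have := hψ.trans (min_le_left _ _)
        exact add_le_add this (hIJ.trans this)
    _ = ε := add_halves ε

end L1Approximation

/-- All the difference quotients of `u` on `s` lie in `[m, M]`. For `0 < m` this makes `u` and its
inverse Lipschitz, and unlike differentiability it is stable under `max` and `min`, so that it
yields elements of `HPlusAC` from piecewise smooth formulas. -/
structure SlopesBetween (m M : ℝ) (u : ℝ → ℝ) (s : Set ℝ) : Prop where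
  mul_sub_le : ∀ x ∈ s, ∀ y ∈ s, x ≤ y → m * (y - x) ≤ u y - u x
  sub_le_mul : ∀ x ∈ s, ∀ y ∈ s, x ≤ y → u y - u x ≤ M * (y - x)

namespace SlopesBetween

variable {m M : ℝ} {u v : ℝ → ℝ} {s t : Set ℝ}

theorem of_sub_eq_mul {k : ℝ} (hm : m ≤ k) (hM : k ≤ M) (h : ∀ x y, u y - u x = k * (y - x))
    (s : Set ℝ) : SlopesBetween m M u s where
  mul_sub_le x _ y _ hxy := by rw [h]; gcongr
  sub_le_mul x _ y _ hxy := by rw [h]; gcongr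

theorem of_deriv (hs : Convex ℝ s) (hc : ContinuousOn u s) (hd : DifferentiableOn ℝ u (interior s))
    (hm : ∀ x ∈ interior s, m ≤ deriv u x) (hM : ∀ x ∈ interior s, deriv u x ≤ M) :
    SlopesBetween m M u s where
  mul_sub_le := hs.mul_sub_le_image_sub_of_le_deriv hc hd hm
  sub_le_mul := hs.image_sub_le_mul_sub_of_deriv_le hc hd hM

theorem max (hu : SlopesBetween m M u s) (hv : SlopesBetween m M v s) :
    SlopesBetween m M (fun x => max (u x) (v x)) s where
  mul_sub_le x hx y hy hxy := le_sub_iff_add_le'.2 <| by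
    rw [← max_add_add_right]
    exact max_le_max (by linarith [hu.mul_sub_le x hx y hy hxy])
      (by linarith [hv.mul_sub_le x hx y hy hxy])
  sub_le_mul x hx y hy hxy := sub_le_iff_le_add'.2 <| by
    rw [← max_add_add_right]
    exact max_le_max (by linarith [hu.sub_le_mul x hx y hy hxy])
      (by linarith [hv.sub_le_mul x hx y hy hxy])

theorem min (hu : SlopesBetween m M u s) (hv : SlopesBetween m M v s) :
    SlopesBetween m M (fun x => min (u x) (v x)) s where
  mul_sub_le x hx y hy hxy := le_sub_iff_add_le'.2 <| by
    rw [← min_add_add_right]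
    exact min_le_min (by linarith [hu.mul_sub_le x hx y hy hxy])
      (by linarith [hv.mul_sub_le x hx y hy hxy])
  sub_le_mul x hx y hy hxy := sub_le_iff_le_add'.2 <| by
    rw [← min_add_add_right]
    exact min_le_min (by linarith [hu.sub_le_mul x hx y hy hxy])
      (by linarith [hv.sub_le_mul x hx y hy hxy])

theorem strictMonoOn (hu : SlopesBetween m M u s) (hm : 0 < m) : StrictMonoOn u s :=
  fun x hx y hy hxy => sub_pos.1 <|
    (mul_pos hm (sub_pos.2 hxy)).trans_le (hu.mul_sub_le x hx y hy hxy.le)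

theorem lipschitzOnWith (hu : SlopesBetween m M u s) (hm : 0 ≤ m) :
    LipschitzOnWith M.toNNReal u s := by
  refine LipschitzOnWith.of_dist_le_mul fun x hx y hy => ?_
  wlog hxy : y ≤ x generalizing x y
  · rw [dist_comm, dist_comm x]; exact this y hy x hx (le_of_not_ge hxy)
  have hinc : 0 ≤ u x - u y :=
    (mul_nonneg hm (sub_nonneg.2 hxy)).trans (hu.mul_sub_le y hy x hx hxy)
  rw [Real.dist_eq, Real.dist_eq, abs_of_nonneg (sub_nonneg.2 hxy), abs_of_nonneg hinc]
  exact (hu.sub_le_mul y hy x hx hxy).trans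
    (mul_le_mul_of_nonneg_right (Real.le_coe_toNNReal M) (sub_nonneg.2 hxy))

theorem of_rightInvOn (hu : SlopesBetween m M u s) (hm : 0 < m) (hM : 0 < M) (hv : MapsTo v t s)
    (huv : RightInvOn v u t) : SlopesBetween M⁻¹ m⁻¹ v t := by
  have hle : ∀ x ∈ t, ∀ y ∈ t, x ≤ y → v x ≤ v y := fun x hx y hy hxy => by
    rwa [← (hu.strictMonoOn hm).le_iff_le (hv hx) (hv hy), huv hx, huv hy]
  constructor <;> intro x hx y hy hxy
  · have := hu.sub_le_mul _ (hv hx) _ (hv hy) (hle x hx y hy hxy)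
    rwa [huv hx, huv hy, ← inv_mul_le_iff₀ hM] at this
  · have := hu.mul_sub_le _ (hv hx) _ (hv hy) (hle x hx y hy hxy)
    rwa [huv hx, huv hy, ← le_inv_mul_iff₀ hm] at this

end SlopesBetween

namespace HPlusAC

variable {a b : ℝ}

/-- An element of the group as a self-map of `ℝ`, extended by the identity outside `[a, b]`. -/
noncomputable abbrev fn (f : HPlusAC a b) : ℝ → ℝ := extendId f.toHomeo

theorem fn_mul (f g : HPlusAC a b) (x : ℝ) : (f * g).fn x = f.fn (g.fn x) :=
  congrFun (extendId_mul f.toHomeo g.toHomeo) x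

theorem fn_one (x : ℝ) : (1 : HPlusAC a b).fn x = x := congrFun extendId_one x

theorem fn_inv_fn (f : HPlusAC a b) (x : ℝ) : f⁻¹.fn (f.fn x) = x := by
  rw [← fn_mul, inv_mul_cancel, fn_one]

theorem fn_fn_inv (f : HPlusAC a b) (x : ℝ) : f.fn (f⁻¹.fn x) = x := by
  rw [← fn_mul, mul_inv_cancel, fn_one]

theorem fn_inv_eq_iff {f : HPlusAC a b} {x y : ℝ} : f⁻¹.fn y = x ↔ f.fn x = y :=
  ⟨fun h => by rw [← h, fn_fn_inv], fun h => by rw [← h, fn_inv_fn]⟩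

theorem strictMono_fn (f : HPlusAC a b) : StrictMono f.fn :=
  (extendId_monotone f.2.1).strictMono_of_injective (Function.LeftInverse.injective f.fn_inv_fn)

theorem fn_inv_lt_iff {f : HPlusAC a b} {x y : ℝ} : f⁻¹.fn x < y ↔ x < f.fn y := by
  rw [← f.strictMono_fn.lt_iff_lt, fn_fn_inv]

theorem mapsTo_fn (f : HPlusAC a b) : MapsTo f.fn (Icc a b) (Icc a b) := fun x hx => by
  rw [fn, extendId_of_mem _ hx]; exact (f.toHomeo ⟨x, hx⟩).2

theorem fn_left (f : HPlusAC a b) : f.fn a = a := extendId_left f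

theorem fn_right (f : HPlusAC a b) : f.fn b = b := by
  by_cases hb : b ∈ Icc a b
  · refine le_antisymm (f.mapsTo_fn hb).2 ?_
    calc b = f.fn (f⁻¹.fn b) := (f.fn_fn_inv b).symm
      _ ≤ f.fn b := f.strictMono_fn.monotone (f⁻¹.mapsTo_fn hb).2
  · exact extendId_of_notMem _ hb

theorem mapsTo_fn_Ioo (f : HPlusAC a b) : MapsTo f.fn (Ioo a b) (Ioo a b) := fun x hx => by
  simpa only [fn_left, fn_right, mem_Ioo] using
    And.intro (f.strictMono_fn hx.1) (f.strictMono_fn hx.2)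

theorem absolutelyContinuousOnInterval_fn (f : HPlusAC a b) :
    AbsolutelyContinuousOnInterval f.fn a b := f.2.2.1

theorem ext_of_eqOn {f g : HPlusAC a b} (h : EqOn f.fn g.fn (Icc a b)) : f = g := by
  refine Subtype.ext (Homeomorph.ext fun x => Subtype.ext ?_)
  have hx := h x.2
  rwa [fn, fn, extendId_of_mem _ x.2, extendId_of_mem _ x.2] at hx

theorem subsingleton_of_le (h : b ≤ a) : Subsingleton (HPlusAC a b) where
  allEq f g := ext_of_eqOn fun x hx => by
    rw [le_antisymm (hx.2.trans h) hx.1, fn_left, fn_left]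

theorem exists_fn_eqOn_of_invOn {u v : ℝ → ℝ} (hu : AbsolutelyContinuousOnInterval u a b)
    (hv : AbsolutelyContinuousOnInterval v a b) (hum : MapsTo u (Icc a b) (Icc a b))
    (hvm : MapsTo v (Icc a b) (Icc a b)) (hmono : MonotoneOn u (Icc a b))
    (hinv : InvOn v u (Icc a b) (Icc a b)) :
    ∃ f : HPlusAC a b, EqOn f.fn u (Icc a b) ∧ EqOn f⁻¹.fn v (Icc a b) := by
  rcases lt_or_ge b a with hba | hab
  · exact ⟨1, by simp [Icc_eq_empty hba.not_ge]⟩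
  let e : Icc a b ≃ Icc a b :=
    { toFun := hum.restrict
      invFun := hvm.restrict
      left_inv := fun x => Subtype.ext (hinv.1 x.2)
      right_inv := fun x => Subtype.ext (hinv.2 x.2) }
  have he : StrictMono e := fun x y hxy =>
    hmono.strictMonoOn_iff_injOn.2 hinv.1.injOn x.2 y.2 hxy
  let F : Icc a b ≃ₜ Icc a b := (he.orderIsoOfSurjective e e.surjective).toHomeomorph
  have hF : EqOn (extendId F) u (Icc a b) := fun x hx => extendId_of_mem F hx
  have hFinv : EqOn (extendId F⁻¹) v (Icc a b) := fun x hx => by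
    have hFv : F⁻¹ ⟨x, hx⟩ = e.symm ⟨x, hx⟩ :=
      (Equiv.eq_symm_apply e).2 (F.apply_symm_apply ⟨x, hx⟩)
    rw [extendId_of_mem _ hx, hFv]
    rfl
  have hsub : uIcc a b ⊆ Icc a b := (uIcc_of_le hab).subset
  exact ⟨⟨F, he, (absolutelyContinuousOnInterval_congr (hF.mono hsub)).2 hu,
    (absolutelyContinuousOnInterval_congr (hFinv.mono hsub)).2 hv⟩, hF, hFinv⟩

theorem exists_fn_eqOn_of_slopesBetween {u : ℝ → ℝ} {m M : ℝ}
    (hu : SlopesBetween m M u (Icc a b)) (hm : 0 < m) (ha : u a = a) (hb : u b = b) :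
    ∃ f : HPlusAC a b, EqOn f.fn u (Icc a b) := by
  rcases le_or_gt b a with hba | hab
  · exact ⟨1, fun x hx => by rw [le_antisymm (hx.2.trans hba) hx.1, fn_left, ha]⟩
  have haI := left_mem_Icc.2 hab.le
  have hbI := right_mem_Icc.2 hab.le
  have hM : 0 < M := by
    have hslope := hu.sub_le_mul a haI b hbI hab.le
    rw [ha, hb] at hslope
    exact pos_of_mul_pos_left ((sub_pos.2 hab).trans_le hslope) (sub_pos.2 hab).le
  have hmono : MonotoneOn u (Icc a b) := (hu.strictMonoOn hm).monotoneOn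
  have hmaps : MapsTo u (Icc a b) (Icc a b) := fun x hx => by
    simpa only [ha, hb, mem_Icc] using And.intro (hmono haI hx hx.1) (hmono hx hbI hx.2)
  have hsurj : SurjOn u (Icc a b) (Icc a b) := by
    have hivt := intermediate_value_Icc hab.le (hu.lipschitzOnWith hm.le).continuousOn
    rwa [ha, hb] at hivt
  have hinv : InvOn (Function.invFunOn u (Icc a b)) u (Icc a b) (Icc a b) :=
    BijOn.invOn_invFunOn ⟨hmaps, (hu.strictMonoOn hm).injOn, hsurj⟩
  have hv := hu.of_rightInvOn hm hM hsurj.mapsTo_invFunOn hinv.2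
  have hsub : uIcc a b ⊆ Icc a b := (uIcc_of_le hab.le).subset
  have hlu := (hu.lipschitzOnWith hm.le).mono hsub
  have hlv := (hv.lipschitzOnWith (inv_pos.2 hM).le).mono hsub
  obtain ⟨f, hf, -⟩ := exists_fn_eqOn_of_invOn hlu.absolutelyContinuousOnInterval
    hlv.absolutelyContinuousOnInterval hmaps hsurj.mapsTo_invFunOn hmono hinv
  exact ⟨f, hf⟩

theorem exists_eqOn_eqOn_id (f : HPlusAC a b) {p : ℝ} (hp : p ∈ Icc a b) (hfp : f.fn p = p) :
    ∃ k : HPlusAC a b, EqOn k.fn f.fn (Icc a p) ∧ EqOn k.fn id (Icc p b) := by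
  let u (g : HPlusAC a b) (x : ℝ) : ℝ := g.fn (min x p) + (max x p - p)
  have hleft (g : HPlusAC a b) {x : ℝ} (hx : x ≤ p) : u g x = g.fn x := by
    simp only [u, min_eq_left hx, max_eq_right hx, sub_self, add_zero]
  have hright {g : HPlusAC a b} (hg : g.fn p = p) {x : ℝ} (hx : p ≤ x) : u g x = x := by
    simp only [u, min_eq_right hx, max_eq_left hx, hg, add_sub_cancel]
  have hac (g : HPlusAC a b) : AbsolutelyContinuousOnInterval (u g) a b :=
    absolutelyContinuousOnInterval_min_add_max g.absolutelyContinuousOnInterval_fn hp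
  have hmono : MonotoneOn (u f) (Icc a b) := fun x _ y _ hxy =>
    add_le_add (f.strictMono_fn.monotone (min_le_min_right p hxy))
      (sub_le_sub_right (max_le_max_right p hxy) p)
  have hfp' : f⁻¹.fn p = p := fn_inv_eq_iff.2 hfp
  have hmaps {g : HPlusAC a b} (hg : g.fn p = p) : MapsTo (u g) (Icc a b) (Icc a b) := by
    intro x hx
    rcases le_total x p with hxp | hpx
    · rw [hleft g hxp]; exact g.mapsTo_fn hx
    · rwa [hright hg hpx]
  have hinv {g h : HPlusAC a b} (hg : g.fn p = p) (hh : h.fn p = p) (hgh : g * h = 1) :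
      LeftInvOn (u g) (u h) (Icc a b) := by
    intro x _
    rcases le_total x p with hxp | hpx
    · have hle : h.fn x ≤ p := (h.strictMono_fn.monotone hxp).trans_eq hh
      rw [hleft h hxp, hleft g hle, ← fn_mul, hgh, fn_one]
    · rw [hright hh hpx, hright hg hpx]
  obtain ⟨k, hk, -⟩ := exists_fn_eqOn_of_invOn (hac f) (hac f⁻¹) (hmaps hfp) (hmaps hfp') hmono
    ⟨hinv hfp' hfp (inv_mul_cancel f), hinv hfp hfp' (mul_inv_cancel f)⟩
  exact ⟨k, fun x hx => (hk ⟨hx.1, hx.2.trans hp.2⟩).trans (hleft f hx.2),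
    fun x hx => (hk ⟨hp.1.trans hx.1, hx.2⟩).trans (hright hfp hx.1)⟩

theorem exists_eqOn_left_eqOn_right (f g : HPlusAC a b) {p : ℝ} (hp : p ∈ Icc a b)
    (hfg : f.fn p = g.fn p) :
    ∃ k : HPlusAC a b, EqOn k.fn f.fn (Icc a p) ∧ EqOn k.fn g.fn (Icc p b) := by
  obtain ⟨k, hkf, hkid⟩ := exists_eqOn_eqOn_id (g⁻¹ * f) hp
    (by rw [fn_mul, hfg, fn_inv_fn])
  refine ⟨g * k, fun x hx => ?_, fun x hx => ?_⟩
  · rw [fn_mul, hkf hx, fn_mul, fn_fn_inv]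
  · rw [fn_mul, hkid hx, id]

theorem exists_fn_eq_eqOn_id_of_lt {c q d : ℝ} (hq : a < q) (hqc : q < c) (hcd : c < d)
    (hdb : d ≤ b) :
    ∃ k : HPlusAC a b, k.fn c = q ∧ EqOn k.fn id (Icc d b) ∧ ∀ x ∈ Ioo a d, k.fn x < x := by
  have hca : 0 < c - a := by linarith
  have hdc : 0 < d - c := by linarith
  set s : ℝ := (q - a) / (c - a) with hs
  set t : ℝ := (d - q) / (d - c) with ht
  have hs0 : 0 < s := div_pos (sub_pos.2 hq) hca
  have hs1 : s < 1 := (div_lt_one hca).2 (by linarith)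
  have ht1 : 1 < t := (one_lt_div hdc).2 (by linarith)
  let u (x : ℝ) : ℝ := min x (max (a + s * (x - a)) (d - t * (d - x)))
  have hu : SlopesBetween s t u (Icc a b) :=
    (SlopesBetween.of_sub_eq_mul hs1.le ht1.le (fun x y => (one_mul _).symm) _).min
      ((SlopesBetween.of_sub_eq_mul le_rfl (hs1.trans ht1).le (fun x y => by ring) _).max
        (SlopesBetween.of_sub_eq_mul (hs1.trans ht1).le le_rfl (fun x y => by ring) _))
  have hid {x : ℝ} (hx : d ≤ x) : u x = x :=
    min_eq_left (le_max_of_le_right (by nlinarith))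
  have hua : u a = a := by
    have hle : d - t * (d - a) ≤ a := by nlinarith
    simp only [u, sub_self, mul_zero, add_zero, max_eq_left hle, min_self]
  obtain ⟨k, hk⟩ := exists_fn_eqOn_of_slopesBetween hu hs0 hua (hid hdb)
  refine ⟨k, ?_, fun x hx => ?_, fun x hx => ?_⟩
  · have hleft : a + s * (c - a) = q := by rw [hs, div_mul_cancel₀ _ hca.ne']; ring
    have hright : d - t * (d - c) = q := by rw [ht, div_mul_cancel₀ _ hdc.ne']; ring
    rw [hk ⟨by linarith, by linarith⟩]
    simp only [u, hleft, hright, max_self, min_eq_right hqc.le]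
  · exact (hk ⟨by linarith [hx.1], hx.2⟩).trans (hid hx.1)
  · rw [hk ⟨hx.1.le, by linarith [hx.2]⟩]
    exact min_lt_of_right_lt (max_lt (by nlinarith [hx.1]) (by nlinarith [hx.2]))

theorem exists_fn_eq_eqOn_id {c q d : ℝ} (hc : c ∈ Ioo a d) (hq : q ∈ Ioo a d) (hdb : d ≤ b) :
    ∃ k : HPlusAC a b, k.fn c = q ∧ EqOn k.fn id (Icc d b) := by
  rcases lt_trichotomy q c with hqc | rfl | hcq
  · obtain ⟨k, hkc, hkid, -⟩ := exists_fn_eq_eqOn_id_of_lt hq.1 hqc hc.2 hdb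
    exact ⟨k, hkc, hkid⟩
  · exact ⟨1, fn_one q, fun x _ => fn_one x⟩
  · obtain ⟨k, hkq, hkid, -⟩ := exists_fn_eq_eqOn_id_of_lt hc.1 hcq hq.2 hdb
    exact ⟨k⁻¹, fn_inv_eq_iff.2 hkq, fun x hx => fn_inv_eq_iff.2 (hkid hx)⟩

theorem exists_eqOn_Icc_left_right (f g : HPlusAC a b) {c d : ℝ} (hc : c ∈ Ioo a b)
    (hd : d ∈ Ioo a b) (hcd : c < d) (hfg : f.fn c < g.fn d) :
    ∃ k : HPlusAC a b, EqOn k.fn f.fn (Icc a c) ∧ EqOn k.fn g.fn (Icc d b) := by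
  set h : HPlusAC a b := g⁻¹ * f with hh
  have hhc : h.fn c ∈ Ioo a d :=
    ⟨(h.mapsTo_fn_Ioo hc).1, by rwa [hh, fn_mul, fn_inv_lt_iff]⟩
  obtain ⟨v, hvc, hvid⟩ := exists_fn_eq_eqOn_id ⟨hc.1, hcd⟩ hhc hd.2.le
  obtain ⟨k, hkh, hkv⟩ := exists_eqOn_left_eqOn_right h v ⟨hc.1.le, hc.2.le⟩ hvc.symm
  refine ⟨g * k, fun x hx => ?_, fun x hx => ?_⟩
  · rw [fn_mul, hkh hx, hh, fn_mul, fn_fn_inv]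
  · rw [fn_mul, hkv ⟨hcd.le.trans hx.1, hx.2⟩, hvid hx, id]

end HPlusAC

namespace HPlusAC

variable {a b : ℝ}

theorem dist_def (f g : HPlusAC a b) :
    dist f g = ∫ x in Icc a b, |deriv f.fn x - deriv g.fn x| := rfl

theorem integral_deriv_fn (f : HPlusAC a b) {x y : ℝ} (hx : x ∈ Icc a b) (hy : y ∈ Icc a b) :
    ∫ t in x..y, deriv f.fn t = f.fn y - f.fn x :=
  (f.absolutelyContinuousOnInterval_fn.mono
    ((uIcc_subset_Icc hx hy).trans Icc_subset_uIcc)).integral_deriv_eq_sub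

theorem setIntegral_deriv_fn (f : HPlusAC a b) {c d : ℝ} (hc : c ∈ Icc a b) (hd : d ∈ Icc a b)
    (hcd : c ≤ d) : ∫ t in Icc c d, deriv f.fn t = f.fn d - f.fn c := by
  rw [integral_Icc_eq_integral_Ioc, ← intervalIntegral.integral_of_le hcd,
    f.integral_deriv_fn hc hd]

theorem deriv_fn_nonneg (f : HPlusAC a b) (x : ℝ) : 0 ≤ deriv f.fn x :=
  f.strictMono_fn.monotone.deriv_nonneg

theorem absolutelyContinuousOnInterval_fn_sub_fn (f g : HPlusAC a b) :
    AbsolutelyContinuousOnInterval (f.fn - g.fn) a b :=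
  f.absolutelyContinuousOnInterval_fn.sub g.absolutelyContinuousOnInterval_fn

theorem boundedVariationOn_fn_sub_fn (hab : a ≤ b) (f g : HPlusAC a b) :
    BoundedVariationOn (f.fn - g.fn) (Icc a b) := by
  simpa only [uIcc_of_le hab] using
    (absolutelyContinuousOnInterval_fn_sub_fn f g).boundedVariationOn

theorem dist_eq_eVariationOn (hab : a ≤ b) (f g : HPlusAC a b) :
    dist f g = (eVariationOn (f.fn - g.fn) (Icc a b)).toReal := by
  rw [← integral_abs_deriv_eq_eVariationOn hab (absolutelyContinuousOnInterval_fn_sub_fn f g),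
    dist_def]
  refine setIntegral_congr_ae measurableSet_Icc ?_
  filter_upwards [f.absolutelyContinuousOnInterval_fn.ae_differentiableAt,
    g.absolutelyContinuousOnInterval_fn.ae_differentiableAt] with x hf hg hx
  rw [uIcc_of_le hab] at hf hg
  rw [deriv_sub (hf hx) (hg hx)]

theorem abs_fn_sub_fn_le_dist (f g : HPlusAC a b) {x : ℝ} (hx : x ∈ Icc a b) :
    |f.fn x - g.fn x| ≤ dist f g := by
  have hab := hx.1.trans hx.2
  have hvar := eVariationOn.edist_le (f.fn - g.fn) hx (left_mem_Icc.2 hab)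
  have hle := ENNReal.toReal_mono (boundedVariationOn_fn_sub_fn hab f g) hvar
  rw [← dist_edist, Real.dist_eq, ← dist_eq_eVariationOn hab] at hle
  simpa only [Pi.sub_apply, fn_left, sub_self, sub_zero] using hle

theorem dist_mul_right_le (f g h : HPlusAC a b) : dist (f * h) (g * h) ≤ dist f g := by
  rcases le_or_gt b a with hba | hab
  · have := subsingleton_of_le hba
    rw [Subsingleton.elim (f * h) f, Subsingleton.elim (g * h) g]
  rw [dist_eq_eVariationOn hab.le, dist_eq_eVariationOn hab.le]
  have hcomp : (f * h).fn - (g * h).fn = (f.fn - g.fn) ∘ h.fn :=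
    funext fun x => congrArg₂ (· - ·) (fn_mul f h x) (fn_mul g h x)
  rw [hcomp]
  exact ENNReal.toReal_mono (boundedVariationOn_fn_sub_fn hab.le f g)
    (eVariationOn.comp_le_of_monotoneOn _ _ (h.strictMono_fn.monotone.monotoneOn _) h.mapsTo_fn)

instance : IsIsometricSMul (HPlusAC a b)ᵐᵒᵖ (HPlusAC a b) where
  isometry_smul h := Isometry.of_dist_eq fun f g => by
    refine le_antisymm (dist_mul_right_le f g h.unop) ?_
    have hinv := dist_mul_right_le (f * h.unop) (g * h.unop) h.unop⁻¹
    rwa [mul_inv_cancel_right, mul_inv_cancel_right] at hinv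

theorem dist_le_of_eqOn {f g : HPlusAC a b} {c d : ℝ} (hc : c ∈ Icc a b) (hd : d ∈ Icc a b)
    (hcd : c ≤ d) (h : EqOn f.fn g.fn (Icc c d)) :
    dist f g ≤ 2 * ((b - a) - (f.fn d - f.fn c)) := by
  have hab := hc.1.trans hc.2
  have hsub : Ioo c d ⊆ Icc a b := fun x hx => ⟨hc.1.trans hx.1.le, hx.2.le.trans hd.2⟩
  have hf := integrableOn_deriv f
  have hg := integrableOn_deriv g
  have hfg : IntegrableOn (fun x => deriv f.fn x + deriv g.fn x) (Icc a b) := hf.add hg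
  have hind := (hf.indicator (measurableSet_Ioo (a := c) (b := d))).const_mul 2
  calc dist f g
      ≤ ∫ x in Icc a b, (deriv f.fn x + deriv g.fn x - 2 * (Ioo c d).indicator (deriv f.fn) x) := by
        refine integral_mono (hf.sub hg).abs (hfg.sub hind) fun x => ?_
        have hf0 := f.deriv_fn_nonneg x
        have hg0 := g.deriv_fn_nonneg x
        dsimp only [Pi.sub_apply, Pi.add_apply]
        by_cases hx : x ∈ Ioo c d
        · rw [indicator_of_mem hx, (h.mono Ioo_subset_Icc_self).deriv isOpen_Ioo hx, sub_self,
            abs_zero]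
          linarith
        · rw [indicator_of_notMem hx, mul_zero, sub_zero, abs_sub_le_iff]
          constructor <;> linarith
    _ = (b - a) + (b - a) - 2 * (f.fn d - f.fn c) := by
        have hmid : ∫ x in Icc a b, (Ioo c d).indicator (deriv f.fn) x = f.fn d - f.fn c := by
          rw [setIntegral_indicator measurableSet_Ioo, inter_eq_right.2 hsub,
            ← integral_Icc_eq_integral_Ioo, f.setIntegral_deriv_fn hc hd hcd]
        have hleft := left_mem_Icc.2 hab
        have hright := right_mem_Icc.2 hab
        rw [integral_sub hfg hind, integral_add hf hg, integral_const_mul, hmid,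
          f.setIntegral_deriv_fn hleft hright hab, g.setIntegral_deriv_fn hleft hright hab,
          fn_right, fn_right, fn_left, fn_left]
    _ = 2 * ((b - a) - (f.fn d - f.fn c)) := by ring

theorem exists_forall_eqOn_dist_lt (hab : a < b) (f : HPlusAC a b) {ε : ℝ} (hε : 0 < ε) :
    ∃ c ∈ Ioo a b, ∃ d ∈ Ioo a b,
      ∀ g : HPlusAC a b, EqOn f.fn g.fn (Icc c d) → dist f g < ε := by
  obtain ⟨η, hη, hηε⟩ := exists_between (lt_min (div_pos hε four_pos) (half_pos (sub_pos.2 hab)))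
  rw [lt_min_iff] at hηε
  have hc : f⁻¹.fn (a + η) ∈ Ioo a b := f⁻¹.mapsTo_fn_Ioo ⟨by linarith, by linarith⟩
  have hd : f⁻¹.fn (b - η) ∈ Ioo a b := f⁻¹.mapsTo_fn_Ioo ⟨by linarith, by linarith⟩
  have hcd : f⁻¹.fn (a + η) ≤ f⁻¹.fn (b - η) := f⁻¹.strictMono_fn.monotone (by linarith)
  refine ⟨_, hc, _, hd, fun g hfg => ?_⟩
  have hdist := dist_le_of_eqOn (Ioo_subset_Icc_self hc) (Ioo_subset_Icc_self hd) hcd hfg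
  rw [fn_fn_inv, fn_fn_inv] at hdist
  linarith

end HPlusAC

section RightInvariantMetric

variable {G : Type*} [Group G] [PseudoMetricSpace G] [IsIsometricSMul Gᵐᵒᵖ G]

theorem continuous_mul_left_of_dense (h : Dense {g : G | Continuous (g * ·)}) (g : G) :
    Continuous (g * ·) := by
  refine continuous_of_uniform_approx_of_continuous fun u hu => ?_
  obtain ⟨ε, hε, hεu⟩ := Metric.mem_uniformity_dist.1 hu
  obtain ⟨k, hk, hkε⟩ := h.exists_dist_lt g hε
  exact ⟨(k * ·), hk, fun x => hεu (by rwa [dist_mul_right])⟩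

theorem isTopologicalGroup_of_continuous_mul_left (h : ∀ g : G, Continuous (g * ·)) :
    IsTopologicalGroup G where
  continuous_mul := continuous_iff_continuousAt.2 fun ⟨f, g⟩ => by
    refine tendsto_iff_dist_tendsto_zero.2 ?_
    have hlim : Tendsto (fun p : G × G => dist p.1 f + dist (f * p.2) (f * g)) (𝓝 (f, g))
        (𝓝 (dist f f + dist (f * g) (f * g))) := by
      have := h f
      exact Continuous.tendsto (by fun_prop) (f, g)
    rw [dist_self, dist_self, add_zero] at hlim
    refine squeeze_zero (fun _ => dist_nonneg) (fun p => ?_) hlim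
    rw [← dist_mul_right p.1 f p.2]
    exact dist_triangle _ _ _
  continuous_inv := continuous_iff_continuousAt.2 fun g => tendsto_iff_dist_tendsto_zero.2 <| by
    have hlim := ((h g⁻¹).tendsto g).dist (tendsto_const_nhds (x := (1 : G)))
    rw [inv_mul_cancel, dist_self] at hlim
    refine hlim.congr fun f => ?_
    rw [← dist_mul_right f⁻¹ g⁻¹ f, inv_mul_cancel, dist_comm]

end RightInvariantMetric

namespace HPlusAC

variable {a b : ℝ}

/-- `f` is a `C¹` diffeomorphism of `[a, b]`: it extends to a `C¹` function on `ℝ` whose derivative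
is positive on `[a, b]`. -/
def IsC1Diffeo (f : HPlusAC a b) : Prop :=
  ∃ F : ℝ → ℝ, ContDiff ℝ 1 F ∧ EqOn f.fn F (Icc a b) ∧ ∀ x ∈ Icc a b, 0 < deriv F x

theorem exists_isC1Diffeo_eqOn {F : ℝ → ℝ} (hF : ContDiff ℝ 1 F)
    (hpos : ∀ x ∈ Icc a b, 0 < deriv F x) (ha : F a = a) (hb : F b = b) :
    ∃ f : HPlusAC a b, f.IsC1Diffeo ∧ EqOn f.fn F (Icc a b) := by
  rcases lt_or_ge b a with hba | hab
  · exact ⟨1, ⟨id, contDiff_id, fun x _ => fn_one x, fun x _ => by simp only [deriv_id, one_pos]⟩,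
      by simp only [Icc_eq_empty hba.not_ge, eqOn_empty]⟩
  have hcont := (hF.continuous_deriv le_rfl).continuousOn (s := Icc a b)
  have hne := nonempty_Icc.2 hab
  obtain ⟨p, hp, hmin⟩ := isCompact_Icc.exists_isMinOn hne hcont
  obtain ⟨q, -, hmax⟩ := isCompact_Icc.exists_isMaxOn hne hcont
  have hslopes : SlopesBetween (deriv F p) (deriv F q) F (Icc a b) :=
    .of_deriv (convex_Icc a b) hF.continuous.continuousOn
      (hF.differentiable one_ne_zero).differentiableOn
      (fun x hx => hmin (interior_subset hx)) (fun x hx => hmax (interior_subset hx))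
  obtain ⟨f, hf⟩ := exists_fn_eqOn_of_slopesBetween hslopes (hpos p hp) ha hb
  exact ⟨f, ⟨F, hF, hf, hpos⟩, hf⟩

theorem deriv_fn_ae_eq {f : HPlusAC a b} {u : ℝ → ℝ} (h : EqOn f.fn u (Icc a b)) :
    deriv f.fn =ᵐ[volume.restrict (Icc a b)] deriv u := by
  rw [← restrict_Ioo_eq_restrict_Icc]
  exact (ae_restrict_mem measurableSet_Ioo).mono fun x hx =>
    (h.mono Ioo_subset_Icc_self).deriv isOpen_Ioo hx

theorem dist_eq_of_eqOn (f : HPlusAC a b) {g : HPlusAC a b} {u : ℝ → ℝ}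
    (h : EqOn g.fn u (Icc a b)) : dist f g = ∫ x in Icc a b, |deriv f.fn x - deriv u x| :=
  integral_congr_ae <| (deriv_fn_ae_eq h).mono fun x hx => by simp only [← hx]

theorem dist_le_of_abs_deriv_sub_le (hab : a ≤ b) {f g : HPlusAC a b} {u v : ℝ → ℝ}
    (hu : EqOn f.fn u (Icc a b)) (hv : EqOn g.fn v (Icc a b)) {C : ℝ}
    (hC : ∀ x ∈ Icc a b, |deriv u x - deriv v x| ≤ C) : dist f g ≤ C * (b - a) := by
  calc dist f g
      ≤ ∫ _ in Icc a b, C := by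
        refine integral_mono_ae ((integrableOn_deriv f).sub (integrableOn_deriv g)).abs
          (integrable_const C) ?_
        filter_upwards [deriv_fn_ae_eq hu, deriv_fn_ae_eq hv, ae_restrict_mem measurableSet_Icc]
          with x hxu hxv hx
        simpa only [← hxu, ← hxv] using hC x hx
    _ = C * (b - a) := by
        rw [setIntegral_const, Real.volume_real_Icc_of_le hab, smul_eq_mul, mul_comm]

theorem dense_setOf_isC1Diffeo : Dense {f : HPlusAC a b | f.IsC1Diffeo} := by
  refine Metric.dense_iff.2 fun f ε hε => ?_
  rcases le_or_gt b a with hba | hab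
  · have := subsingleton_of_le hba
    obtain ⟨g, hg, -⟩ := exists_isC1Diffeo_eqOn (a := a) (b := b) contDiff_id
      (fun x _ => by simp only [deriv_id, one_pos]) rfl rfl
    exact ⟨g, by rwa [Subsingleton.elim f g, Metric.mem_ball, dist_self], hg⟩
  have hint := f.setIntegral_deriv_fn (left_mem_Icc.2 hab.le) (right_mem_Icc.2 hab.le) hab.le
  rw [fn_left, fn_right] at hint
  obtain ⟨φ, hφ, hφpos, -, hφint, hφε⟩ := exists_continuous_pos_integral_eq_integral_abs_sub_le
    (integrableOn_deriv f) (.of_forall f.deriv_fn_nonneg)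
    ((sub_pos.2 hab).trans_eq hint.symm) (half_pos hε)
  let F (x : ℝ) : ℝ := a + ∫ t in a..x, φ t
  have hderiv (x : ℝ) : HasDerivAt F (φ x) x :=
    (hφ.integral_hasStrictDerivAt a x).hasDerivAt.const_add a
  have hdF : deriv F = φ := funext fun x => (hderiv x).deriv
  have hF : ContDiff ℝ 1 F := contDiff_one_iff_deriv.2
    ⟨fun x => (hderiv x).differentiableAt, by rwa [hdF]⟩
  have hFa : F a = a := by simp only [F, intervalIntegral.integral_same, add_zero]
  have hFb : F b = b := by
    rw [integral_Icc_eq_integral_Ioc, ← intervalIntegral.integral_of_le hab.le, hint] at hφint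
    simp only [F, hφint, add_sub_cancel]
  obtain ⟨g, hg, hgF⟩ := exists_isC1Diffeo_eqOn hF (fun x _ => by rw [hdF]; exact hφpos x)
    hFa hFb
  refine ⟨g, ?_, hg⟩
  rw [Metric.mem_ball', dist_eq_of_eqOn f hgF, hdF]
  exact hφε.trans_lt (half_lt_self hε)

theorem IsC1Diffeo.exists_dist_lt_fn_eq_add_mul {f : HPlusAC a b} (hf : f.IsC1Diffeo) (hab : a < b)
    {ε : ℝ} (hε : 0 < ε) :
    ∃ η > 0, ∀ s : ℝ, |s| < η → ∃ g : HPlusAC a b, dist f g < ε ∧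
      ∀ x ∈ Icc a b, g.fn x = f.fn x + s * ((x - a) * (b - x)) := by
  obtain ⟨F, hF, hfF, hpos⟩ := hf
  have hlen := sub_pos.2 hab
  obtain ⟨p, hp, hmin⟩ := isCompact_Icc.exists_isMinOn (nonempty_Icc.2 hab.le)
    ((hF.continuous_deriv le_rfl).continuousOn (s := Icc a b))
  refine ⟨min (deriv F p / (b - a)) (ε / (b - a) / (b - a)),
    lt_min (div_pos (hpos p hp) hlen) (by positivity), fun s hs => ?_⟩
  rw [lt_min_iff, lt_div_iff₀ hlen, lt_div_iff₀ hlen, lt_div_iff₀ hlen] at hs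
  let u (x : ℝ) : ℝ := F x + s * ((x - a) * (b - x))
  have hu : ContDiff ℝ 1 u := by fun_prop
  have hderiv (x : ℝ) : deriv u x = deriv F x + s * (a + b - 2 * x) := by
    have hbump := (((hasDerivAt_id x).sub_const a).mul ((hasDerivAt_id x).const_sub b)).const_mul s
    refine (((hF.differentiable one_ne_zero x).hasDerivAt.add hbump).congr_deriv ?_).deriv
    simp only [id]
    ring
  have hbump (x : ℝ) (hx : x ∈ Icc a b) : |s * (a + b - 2 * x)| ≤ |s| * (b - a) := by
    rw [abs_mul]
    gcongr
    exact abs_le.2 ⟨by linarith [hx.2], by linarith [hx.1]⟩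
  have hFa : F a = a := by rw [← hfF (left_mem_Icc.2 hab.le), fn_left]
  have hFb : F b = b := by rw [← hfF (right_mem_Icc.2 hab.le), fn_right]
  have hpos' (x : ℝ) (hx : x ∈ Icc a b) : 0 < deriv u x := by
    have hFp : deriv F p ≤ deriv F x := hmin hx
    rw [hderiv]
    linarith [neg_abs_le (s * (a + b - 2 * x)), hbump x hx]
  obtain ⟨g, -, hg⟩ := exists_isC1Diffeo_eqOn hu hpos' (by simp only [u, hFa]; ring)
    (by simp only [u, hFb]; ring)
  refine ⟨g, ?_, fun x hx => (hg hx).trans (by simp only [u, hfF hx])⟩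
  refine (dist_le_of_abs_deriv_sub_le hab.le hfF hg fun x hx => ?_).trans_lt hs.2
  rw [hderiv, sub_add_cancel_left, abs_neg]
  exact hbump x hx

theorem dist_mul_left_le {h : HPlusAC a b} {F : ℝ → ℝ} (hF : Differentiable ℝ F)
    (hhF : EqOn h.fn F (Icc a b)) {M ω : ℝ} (hM : ∀ x ∈ Icc a b, |deriv F x| ≤ M)
    (hab : a ≤ b) {f g : HPlusAC a b}
    (hω : ∀ x ∈ Icc a b, |deriv F (f.fn x) - deriv F (g.fn x)| ≤ ω) :
    dist (h * f) (h * g) ≤ ω * (b - a) + M * dist f g := by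
  have hchain (k : HPlusAC a b) : ∀ᵐ x ∂volume.restrict (Icc a b),
      deriv (h * k).fn x = deriv F (k.fn x) * deriv k.fn x := by
    have heq : EqOn (h * k).fn (F ∘ k.fn) (Icc a b) := fun x hx =>
      (fn_mul h k x).trans (hhF (k.mapsTo_fn hx))
    filter_upwards [deriv_fn_ae_eq heq,
      ae_restrict_of_ae k.strictMono_fn.monotone.ae_differentiableAt] with x hx hk
    rw [hx, deriv_comp x (hF _) hk]
  have hdiff : IntegrableOn (fun x => |deriv f.fn x - deriv g.fn x|) (Icc a b) :=
    ((integrableOn_deriv f).sub (integrableOn_deriv g)).abs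
  have hf : IntegrableOn (fun x => ω * deriv f.fn x) (Icc a b) := (integrableOn_deriv f).const_mul ω
  calc dist (h * f) (h * g)
      ≤ ∫ x in Icc a b, (ω * deriv f.fn x + M * |deriv f.fn x - deriv g.fn x|) := by
        refine integral_mono_ae ((integrableOn_deriv _).sub (integrableOn_deriv _)).abs
          (hf.add (hdiff.const_mul M)) ?_
        filter_upwards [hchain f, hchain g, ae_restrict_mem measurableSet_Icc] with x hxf hxg hx
        calc |deriv (h * f).fn x - deriv (h * g).fn x|
            = |(deriv F (f.fn x) - deriv F (g.fn x)) * deriv f.fn x +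
                deriv F (g.fn x) * (deriv f.fn x - deriv g.fn x)| := by
              rw [hxf, hxg]; ring_nf
          _ ≤ ω * deriv f.fn x + M * |deriv f.fn x - deriv g.fn x| := by
              refine (abs_add_le _ _).trans (add_le_add ?_ ?_)
              · rw [abs_mul, abs_of_nonneg (f.deriv_fn_nonneg x)]
                exact mul_le_mul_of_nonneg_right (hω x hx) (f.deriv_fn_nonneg x)
              · rw [abs_mul]
                exact mul_le_mul_of_nonneg_right (hM _ (g.mapsTo_fn hx)) (abs_nonneg _)
    _ = ω * (b - a) + M * dist f g := by
        rw [integral_add hf (hdiff.const_mul M), integral_const_mul, integral_const_mul,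
          f.setIntegral_deriv_fn (left_mem_Icc.2 hab) (right_mem_Icc.2 hab) hab, fn_left, fn_right,
          ← dist_def]

theorem IsC1Diffeo.continuous_mul_left {h : HPlusAC a b} (hh : h.IsC1Diffeo) :
    Continuous (h * ·) := by
  rcases le_or_gt b a with hba | hab
  · have := subsingleton_of_le hba
    exact continuous_of_discreteTopology
  obtain ⟨F, hF, hhF, -⟩ := hh
  have hcont := hF.continuous_deriv le_rfl
  obtain ⟨M, hM⟩ :=
    (isCompact_Icc (a := a) (b := b)).exists_bound_of_continuousOn hcont.continuousOn
  have huc := isCompact_Icc.uniformContinuousOn_of_continuous (hcont.continuousOn (s := Icc a b))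
  have hM0 : 0 ≤ M := (norm_nonneg _).trans (hM a (left_mem_Icc.2 hab.le))
  have hlen := sub_pos.2 hab
  refine Metric.continuous_iff.2 fun g ε hε => ?_
  obtain ⟨δ, hδ, hω⟩ := Metric.uniformContinuousOn_iff_le.1 huc (ε / 2 / (b - a)) (by positivity)
  refine ⟨min δ (ε / 2 / (M + 1)), by positivity, fun f hf => ?_⟩
  rw [lt_min_iff, lt_div_iff₀ (by positivity)] at hf
  have hle := dist_mul_left_le (hF.differentiable one_ne_zero) hhF hM hab.le (f := f) (g := g)
    fun x hx => hω _ (f.mapsTo_fn hx) _ (g.mapsTo_fn hx)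
      ((abs_fn_sub_fn_le_dist f g hx).trans hf.1.le)
  rw [div_mul_cancel₀ _ hlen.ne'] at hle
  linarith [dist_nonneg (x := f) (y := g)]

instance : IsTopologicalGroup (HPlusAC a b) :=
  isTopologicalGroup_of_continuous_mul_left <| continuous_mul_left_of_dense <|
    dense_setOf_isC1Diffeo.mono fun _ hf => hf.continuous_mul_left

theorem IsC1Diffeo.contDiffOn_fn {f : HPlusAC a b} (hf : f.IsC1Diffeo) :
    ContDiffOn ℝ 1 f.fn (Ioo a b) := by
  obtain ⟨F, hF, hfF, -⟩ := hf
  exact hF.contDiffOn.congr (hfF.mono Ioo_subset_Icc_self)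

/- The pairs `(s, t)` to be avoided are the points of a curve, which is `C¹` and hence has a dense
complement in the plane. -/
theorem exists_abs_lt_forall_not_common_fixed {u v : ℝ → ℝ} (hu : ContDiffOn ℝ 1 u (Ioo a b))
    (hv : ContDiffOn ℝ 1 v (Ioo a b)) {η : ℝ} (hη : 0 < η) :
    ∃ s t : ℝ, |s| < η ∧ |t| < η ∧ ∀ x ∈ Ioo a b,
      u x + s * ((x - a) * (b - x)) = x → v x + t * ((x - a) * (b - x)) ≠ x := by
  have hbump : ∀ x ∈ Ioo a b, (x - a) * (b - x) ≠ 0 := fun x hx =>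
    (mul_pos (sub_pos.2 hx.1) (sub_pos.2 hx.2)).ne'
  have hcurve : ContDiffOn ℝ 1 (fun x => ((x - u x) / ((x - a) * (b - x)),
      (x - v x) / ((x - a) * (b - x)))) (Ioo a b) :=
    ((contDiffOn_id.sub hu).div (by fun_prop) hbump).prodMk
      ((contDiffOn_id.sub hv).div (by fun_prop) hbump)
  obtain ⟨⟨s, t⟩, hst, hmem⟩ := (dense_compl_image_of_contDiffOn_real (by simp) hcurve
    (convex_Ioo a b)).exists_mem_open Metric.isOpen_ball ((Metric.nonempty_ball (x := 0)).2 hη)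
  rw [mem_ball_zero_iff, Prod.norm_mk, max_lt_iff] at hmem
  refine ⟨s, t, hmem.1, hmem.2, fun x hx hxu hxv => hst ⟨x, hx, Prod.ext ?_ ?_⟩⟩
  · exact (div_eq_iff (hbump x hx)).2 (by linarith)
  · exact (div_eq_iff (hbump x hx)).2 (by linarith)

theorem exists_dist_lt_forall_not_common_fixed (hab : a < b) (f g : HPlusAC a b) {ε : ℝ}
    (hε : 0 < ε) :
    ∃ f' g' : HPlusAC a b, dist f f' < ε ∧ dist g g' < ε ∧
      ∀ x ∈ Ioo a b, f'.fn x = x → g'.fn x ≠ x := by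
  obtain ⟨k, hk, hfk⟩ := dense_setOf_isC1Diffeo.exists_dist_lt f (half_pos hε)
  obtain ⟨l, hl, hgl⟩ := dense_setOf_isC1Diffeo.exists_dist_lt g (half_pos hε)
  obtain ⟨η, hη, hkη⟩ := hk.exists_dist_lt_fn_eq_add_mul hab (half_pos hε)
  obtain ⟨θ, hθ, hlθ⟩ := hl.exists_dist_lt_fn_eq_add_mul hab (half_pos hε)
  obtain ⟨s, t, hs, ht, hst⟩ :=
    exists_abs_lt_forall_not_common_fixed hk.contDiffOn_fn hl.contDiffOn_fn (lt_min hη hθ)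
  obtain ⟨f', hf', hfs⟩ := hkη s (hs.trans_le (min_le_left _ _))
  obtain ⟨g', hg', hgt⟩ := hlθ t (ht.trans_le (min_le_right _ _))
  refine ⟨f', g', by linarith [dist_triangle f k f'], by linarith [dist_triangle g l g'],
    fun x hx => ?_⟩
  rw [hfs x (Ioo_subset_Icc_self hx), hgt x (Ioo_subset_Icc_self hx)]
  exact hst x hx

end HPlusAC

namespace HPlusAC

variable {a b : ℝ}

/-- The derivative of `f` as an element of `L¹([a, b])`. -/
noncomputable def derivL1 (f : HPlusAC a b) : Lp ℝ 1 (volume.restrict (Icc a b)) :=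
  Integrable.toL1 (deriv f.fn) (integrableOn_deriv f)

/-- The primitive of `φ ∈ L¹([a, b])` with value `a` at `a`: the only candidate on `[a, b]` for an
element of the group with derivative `φ`. -/
noncomputable def primitive (φ : Lp ℝ 1 (volume.restrict (Icc a b))) (x : ℝ) : ℝ :=
  a + ∫ t in a..x, φ t

theorem coeFn_derivL1 (f : HPlusAC a b) :
    f.derivL1 =ᵐ[volume.restrict (Icc a b)] deriv f.fn :=
  Integrable.coeFn_toL1 _

theorem isometry_derivL1 : Isometry (derivL1 : HPlusAC a b → _) :=
  Isometry.of_dist_eq fun f g => by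
    rw [L1.dist_eq_integral_dist, dist_def]
    refine integral_congr_ae ?_
    filter_upwards [f.coeFn_derivL1, g.coeFn_derivL1] with x hf hg
    rw [hf, hg, Real.dist_eq]

theorem absolutelyContinuousOnInterval_primitive (hab : a ≤ b)
    (φ : Lp ℝ 1 (volume.restrict (Icc a b))) :
    AbsolutelyContinuousOnInterval (primitive φ) a b :=
  (LipschitzWith.const a).lipschitzOnWith.absolutelyContinuousOnInterval.fun_add
    (((intervalIntegrable_iff_integrableOn_Icc_of_le hab).2
      (L1.integrable_coeFn φ)).absolutelyContinuousOnInterval_intervalIntegral left_mem_uIcc)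

theorem abs_fn_sub_primitive_le (f : HPlusAC a b) (φ : Lp ℝ 1 (volume.restrict (Icc a b))) {x : ℝ}
    (hx : x ∈ Icc a b) : |f.fn x - primitive φ x| ≤ dist f.derivL1 φ := by
  have hf := integrableOn_deriv f
  have hφ : IntegrableOn φ (Icc a b) := L1.integrable_coeFn φ
  have hsub : Ioc a x ⊆ Icc a b := Ioc_subset_Icc_self.trans (Icc_subset_Icc_right hx.2)
  have hint := f.integral_deriv_fn (left_mem_Icc.2 (hx.1.trans hx.2)) hx
  rw [fn_left, intervalIntegral.integral_of_le hx.1] at hint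
  calc |f.fn x - primitive φ x|
      = |∫ t in Ioc a x, (deriv f.fn t - φ t)| := by
        rw [integral_sub (hf.mono_set hsub) (hφ.mono_set hsub), hint, primitive,
          intervalIntegral.integral_of_le hx.1, sub_sub]
    _ ≤ ∫ t in Ioc a x, |deriv f.fn t - φ t| := abs_integral_le_integral_abs
    _ ≤ ∫ t in Icc a b, |deriv f.fn t - φ t| :=
        setIntegral_mono_set (hf.sub hφ).abs (.of_forall fun _ => abs_nonneg _) hsub.eventuallyLE
    _ = dist f.derivL1 φ := by
        rw [L1.dist_eq_integral_dist]
        refine integral_congr_ae (f.coeFn_derivL1.mono fun t ht => ?_)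
        simp only [ht, Real.dist_eq]

theorem derivL1_eq_of_eqOn_primitive {f : HPlusAC a b} {φ : Lp ℝ 1 (volume.restrict (Icc a b))}
    (hab : a ≤ b) (h : EqOn f.fn (primitive φ) (Icc a b)) : f.derivL1 = φ := by
  refine Lp.ext (f.coeFn_derivL1.trans ((deriv_fn_ae_eq h).trans ?_))
  have hφ := ((intervalIntegrable_iff_integrableOn_Icc_of_le hab).2
    (L1.integrable_coeFn φ)).ae_hasDerivAt_integral
  rw [uIcc_of_le hab] at hφ
  filter_upwards [ae_restrict_of_ae hφ, ae_restrict_mem measurableSet_Icc] with x hderiv hx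
  exact ((hderiv hx a (left_mem_Icc.2 hab)).const_add a).deriv

section Limits

variable {ι : Type*} {l : Filter ι} {f : ι → HPlusAC a b}
  {φ ψ : Lp ℝ 1 (volume.restrict (Icc a b))}

theorem tendsto_fn_primitive (h : Tendsto (fun i => (f i).derivL1) l (𝓝 φ)) {x : ℝ}
    (hx : x ∈ Icc a b) : Tendsto (fun i => (f i).fn x) l (𝓝 (primitive φ x)) :=
  tendsto_iff_dist_tendsto_zero.2 <| squeeze_zero (fun _ => dist_nonneg)
    (fun i => abs_fn_sub_primitive_le (f i) φ hx) (tendsto_iff_dist_tendsto_zero.1 h)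

variable [l.NeBot]

theorem mapsTo_primitive (h : Tendsto (fun i => (f i).derivL1) l (𝓝 φ)) :
    MapsTo (primitive φ) (Icc a b) (Icc a b) := fun _ hx =>
  isClosed_Icc.mem_of_tendsto (tendsto_fn_primitive h hx)
    (.of_forall fun i => (f i).mapsTo_fn hx)

theorem monotoneOn_primitive (h : Tendsto (fun i => (f i).derivL1) l (𝓝 φ)) :
    MonotoneOn (primitive φ) (Icc a b) := fun _ hx _ hy hxy =>
  le_of_tendsto_of_tendsto' (tendsto_fn_primitive h hx) (tendsto_fn_primitive h hy)
    fun i => (f i).strictMono_fn.monotone hxy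

theorem leftInvOn_primitive (hφ : Tendsto (fun i => (f i).derivL1) l (𝓝 φ))
    (hψ : Tendsto (fun i => (f i)⁻¹.derivL1) l (𝓝 ψ)) :
    LeftInvOn (primitive φ) (primitive ψ) (Icc a b) := fun y hy => by
  have hab := hy.1.trans hy.2
  have hcont := (absolutelyContinuousOnInterval_primitive hab φ).continuousOn
  rw [uIcc_of_le hab] at hcont
  have hlim : Tendsto (fun i => primitive φ ((f i)⁻¹.fn y)) l (𝓝 (primitive φ (primitive ψ y))) :=
    (hcont _ (mapsTo_primitive hψ hy)).tendsto.comp (tendsto_nhdsWithin_iff.2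
      ⟨tendsto_fn_primitive hψ hy, .of_forall fun i => (f i)⁻¹.mapsTo_fn hy⟩)
  refine tendsto_nhds_unique hlim (tendsto_iff_dist_tendsto_zero.2 ?_)
  refine squeeze_zero (fun _ => dist_nonneg) (fun i => ?_) (tendsto_iff_dist_tendsto_zero.1 hφ)
  simpa only [fn_fn_inv, ← Real.dist_eq, dist_comm y] using
    abs_fn_sub_primitive_le (f i) φ ((f i)⁻¹.mapsTo_fn hy)

end Limits

theorem isClosed_range_derivL1_prodMk_derivL1_inv (hab : a ≤ b) :
    IsClosed (range fun f : HPlusAC a b => (f.derivL1, f⁻¹.derivL1)) := by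
  refine IsSeqClosed.isClosed fun x p hx hlim => ?_
  choose f hf using hx
  obtain rfl : (fun n => ((f n).derivL1, (f n)⁻¹.derivL1)) = x := funext hf
  have hφ : Tendsto (fun n => (f n).derivL1) atTop (𝓝 p.1) := (continuous_fst.tendsto p).comp hlim
  have hψ : Tendsto (fun n => (f n)⁻¹.derivL1) atTop (𝓝 p.2) :=
    (continuous_snd.tendsto p).comp hlim
  obtain ⟨k, hk, hk'⟩ := exists_fn_eqOn_of_invOn
    (absolutelyContinuousOnInterval_primitive hab p.1)
    (absolutelyContinuousOnInterval_primitive hab p.2)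
    (mapsTo_primitive hφ) (mapsTo_primitive hψ) (monotoneOn_primitive hφ)
    ⟨leftInvOn_primitive hψ (by simpa only [inv_inv] using hφ), leftInvOn_primitive hφ hψ⟩
  exact ⟨k, Prod.ext (derivL1_eq_of_eqOn_primitive hab hk)
    (derivL1_eq_of_eqOn_primitive hab hk')⟩

instance : PolishSpace (HPlusAC a b) := by
  rcases lt_or_ge b a with hba | hab
  · have := subsingleton_of_le hba.le
    infer_instance
  have : Fact ((1 : ENNReal) ≠ ⊤) := ⟨ENNReal.one_ne_top⟩
  have hcont : Continuous fun f : HPlusAC a b => (f.derivL1, f⁻¹.derivL1) :=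
    isometry_derivL1.continuous.prodMk (isometry_derivL1.continuous.comp continuous_inv)
  exact IsClosedEmbedding.polishSpace
    ⟨.of_comp hcont continuous_fst isometry_derivL1.isEmbedding,
      isClosed_range_derivL1_prodMk_derivL1_inv hab⟩

end HPlusAC

namespace HPlusAC

variable {a b : ℝ}

theorem lt_fn_inv_iff {f : HPlusAC a b} {x y : ℝ} : x < f⁻¹.fn y ↔ f.fn x < y := by
  rw [← fn_inv_lt_iff, inv_inv]

theorem exists_mem_fn_lt {Γ : Subgroup (HPlusAC a b)} {r p : ℝ}
    (hΓ : ∀ x ∈ Ioc a r, ∃ k ∈ Γ, k.fn x ≠ x) (hp : a < p) : ∃ k ∈ Γ, k.fn r < p := by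
  by_contra! hle
  set S : Set ℝ := (fun k : HPlusAC a b => k.fn r) '' Γ
  have hr : r ∈ S := ⟨1, one_mem Γ, fn_one r⟩
  have hpS : p ∈ lowerBounds S := forall_mem_image.2 hle
  have hS : IsGLB S (sInf S) := isGLB_csInf ⟨r, hr⟩ ⟨p, hpS⟩
  have hnot_lt (k : HPlusAC a b) (hk : k ∈ Γ) : ¬ k.fn (sInf S) < sInf S := fun hlt => by
    obtain ⟨_, ⟨l, hl, rfl⟩, -, hlk⟩ := hS.exists_between (lt_fn_inv_iff.2 hlt)
    refine (lt_fn_inv_iff.1 hlk).not_ge ?_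
    rw [← fn_mul]
    exact hS.1 (mem_image_of_mem _ (mul_mem hk hl))
  obtain ⟨k, hk, hkne⟩ := hΓ (sInf S) ⟨hp.trans_le (hS.2 hpS), hS.1 hr⟩
  rcases hkne.lt_or_gt with hlt | hgt
  · exact hnot_lt k hk hlt
  · exact hnot_lt k⁻¹ (inv_mem hk) (fn_inv_lt_iff.2 hgt)

theorem exists_mem_closure_eqOn {f g k : HPlusAC a b} (hk : k ∈ Subgroup.closure {f, g}) :
    ∀ y ∈ Ioo a b, ∃ q ∈ Ioo a b, ∀ g' : HPlusAC a b, EqOn g'.fn g.fn (Icc q b) →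
      ∃ k' ∈ Subgroup.closure {f, g'}, EqOn k'.fn k.fn (Icc y b) := by
  have hmaps (k : HPlusAC a b) {y : ℝ} : MapsTo k.fn (Icc y b) (Icc (k.fn y) b) := fun z hz =>
    ⟨k.strictMono_fn.monotone hz.1, (k.strictMono_fn.monotone hz.2).trans_eq k.fn_right⟩
  induction hk using Subgroup.closure_induction with
  | mem k hk =>
    refine fun y hy => ⟨y, hy, fun g' hg' => ?_⟩
    rcases hk with rfl | rfl
    · exact ⟨k, Subgroup.mem_closure_of_mem (mem_insert _ _), eqOn_refl _ _⟩
    · exact ⟨g', Subgroup.mem_closure_of_mem (mem_insert_of_mem _ rfl), hg'⟩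
  | one => exact fun y hy => ⟨y, hy, fun g' _ => ⟨1, one_mem _, eqOn_refl _ _⟩⟩
  | mul k l _ _ ihk ihl =>
    intro y hy
    obtain ⟨q₁, hq₁, hk⟩ := ihk (l.fn y) (l.mapsTo_fn_Ioo hy)
    obtain ⟨q₂, hq₂, hl⟩ := ihl y hy
    refine ⟨min q₁ q₂, ⟨lt_min hq₁.1 hq₂.1, min_lt_of_left_lt hq₁.2⟩, fun g' hg' => ?_⟩
    obtain ⟨k', hk', hkeq⟩ := hk g' (hg'.mono (Icc_subset_Icc_left (min_le_left _ _)))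
    obtain ⟨l', hl', hleq⟩ := hl g' (hg'.mono (Icc_subset_Icc_left (min_le_right _ _)))
    refine ⟨k' * l', mul_mem hk' hl', fun z hz => ?_⟩
    rw [fn_mul, fn_mul, hleq hz, hkeq (hmaps l hz)]
  | inv k _ ih =>
    intro y hy
    obtain ⟨q, hq, hk⟩ := ih (k⁻¹.fn y) (k⁻¹.mapsTo_fn_Ioo hy)
    refine ⟨q, hq, fun g' hg' => ?_⟩
    obtain ⟨k', hk', hkeq⟩ := hk g' hg'
    exact ⟨k'⁻¹, inv_mem hk', fun z hz =>
      fn_inv_eq_iff.2 ((hkeq (hmaps k⁻¹ hz)).trans (k.fn_fn_inv z))⟩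

/- The contraction is `f ^ n * k` with `k ∈ ⟨f, g⟩` fixed in advance: only `k` involves `g`, which
is why `q` does not depend on `p`. -/
theorem exists_contraction {f g : HPlusAC a b} (hfg : ∀ x ∈ Ioo a b, f.fn x = x → g.fn x ≠ x)
    {r : ℝ} (hr : r ∈ Ioo a b) (hfr : ∀ x ∈ Ioc a r, f.fn x ≠ x) {y z : ℝ} (hy : y ∈ Ioo a b)
    (hz : z < b) :
    ∃ q ∈ Ioo a b, ∀ p > a, ∃ k : HPlusAC a b, k.fn z < p ∧
      ∀ g' : HPlusAC a b, EqOn g'.fn g.fn (Icc q b) →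
        ∃ k' ∈ Subgroup.closure {f, g'}, EqOn k'.fn k.fn (Icc y b) := by
  have hmoved : ∀ x ∈ Ioc a z, ∃ k ∈ Subgroup.closure {f, g}, k.fn x ≠ x := fun x hx => by
    by_cases hfx : f.fn x = x
    · exact ⟨g, Subgroup.mem_closure_of_mem (mem_insert_of_mem _ rfl),
        hfg x ⟨hx.1, hx.2.trans_lt hz⟩ hfx⟩
    · exact ⟨f, Subgroup.mem_closure_of_mem (mem_insert _ _), hfx⟩
  obtain ⟨k, hk, hkz⟩ := exists_mem_fn_lt hmoved hr.1
  obtain ⟨q, hq, hstable⟩ := exists_mem_closure_eqOn hk y hy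
  refine ⟨q, hq, fun p hp => ?_⟩
  obtain ⟨e, he, her⟩ := exists_mem_fn_lt
    (fun x hx => ⟨f, Subgroup.mem_zpowers f, hfr x hx⟩) hp
  refine ⟨e * k, ?_, fun g' hg' => ?_⟩
  · rw [fn_mul]
    exact (e.strictMono_fn hkz).trans her
  · obtain ⟨k', hk', hkeq⟩ := hstable g' hg'
    have hef : e ∈ Subgroup.closure {f, g'} := Subgroup.zpowers_le_of_mem
      (Subgroup.mem_closure_of_mem (mem_insert _ _)) he
    exact ⟨e * k', mul_mem hef hk', fun x hx => by rw [fn_mul, fn_mul, hkeq hx]⟩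

theorem exists_eqOn_exists_mem_closure_eqOn_of_forall_fn_ne {f g : HPlusAC a b}
    (hfg : ∀ x ∈ Ioo a b, f.fn x = x → g.fn x ≠ x) {r : ℝ} (hr : r ∈ Ioo a b)
    (hfr : ∀ x ∈ Ioc a r, f.fn x ≠ x) {p : ℝ} (hp : p ∈ Ioo a b) (h : HPlusAC a b) {c d : ℝ}
    (hc : c ∈ Ioo a b) (hd : d ∈ Ioo a b) :
    ∃ g' : HPlusAC a b, EqOn g.fn g'.fn (Icc p b) ∧
      ∃ w ∈ Subgroup.closure {f, g'}, EqOn h.fn w.fn (Icc c d) := by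
  have hhc := h.mapsTo_fn_Ioo hc
  have hhd := h.mapsTo_fn_Ioo hd
  obtain ⟨q, hq, hcontract⟩ := exists_contraction hfg hr hfr
    (y := min c (h.fn c)) ⟨lt_min hc.1 hhc.1, min_lt_of_left_lt hc.2⟩
    (z := max d (h.fn d)) (max_lt hd.2 hhd.2)
  have hs : min p q ∈ Ioo a b := ⟨lt_min hp.1 hq.1, min_lt_of_left_lt hp.2⟩
  set s := min p q
  obtain ⟨k, hk, hstable⟩ := hcontract _ (lt_min hs.1 (g.mapsTo_fn_Ioo hs).1)
  have hkd : k.fn d < s :=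
    ((k.strictMono_fn.monotone (le_max_left _ _)).trans_lt hk).trans_le (min_le_left _ _)
  have hkhd : (k * h * k⁻¹).fn (k.fn d) < g.fn s := by
    rw [fn_mul, fn_inv_fn, fn_mul]
    exact ((k.strictMono_fn.monotone (le_max_right _ _)).trans_lt hk).trans_le (min_le_right _ _)
  obtain ⟨g', hg'k, hg'g⟩ :=
    exists_eqOn_Icc_left_right (k * h * k⁻¹) g (k.mapsTo_fn_Ioo hd) hs hkd hkhd
  obtain ⟨k', hk', hkk'⟩ := hstable g' (hg'g.mono (Icc_subset_Icc_left (min_le_right p q)))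
  refine ⟨g', (hg'g.mono (Icc_subset_Icc_left (min_le_left p q))).symm, k'⁻¹ * g' * k',
    mul_mem (mul_mem (inv_mem hk') (Subgroup.mem_closure_of_mem (mem_insert_of_mem _ rfl))) hk',
    fun x hx => ?_⟩
  have hxb : x ∈ Icc a b := ⟨hc.1.le.trans hx.1, hx.2.trans hd.2.le⟩
  have hk'x : k'.fn x = k.fn x := hkk' ⟨min_le_of_left_le hx.1, hxb.2⟩
  have hk'hx : k'.fn (h.fn x) = k.fn (h.fn x) :=
    hkk' ⟨min_le_of_right_le (h.strictMono_fn.monotone hx.1), (h.mapsTo_fn hxb).2⟩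
  have hg'x : g'.fn (k.fn x) = k.fn (h.fn x) := by
    rw [hg'k ⟨(k.mapsTo_fn hxb).1, k.strictMono_fn.monotone hx.2⟩, fn_mul, fn_inv_fn, fn_mul]
  rw [fn_mul, fn_mul, hk'x, hg'x, ← hk'hx, fn_inv_fn]

theorem exists_fn_eq_forall_fn_ne {c q : ℝ} (hc : c ∈ Ioo a b) (hq : q ∈ Ioo a b) (hqc : q ≠ c) :
    ∃ k : HPlusAC a b, k.fn c = q ∧ ∀ x ∈ Ioc a c, k.fn x ≠ x := by
  rcases hqc.lt_or_gt with hlt | hgt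
  · obtain ⟨k, hkc, -, hk⟩ := exists_fn_eq_eqOn_id_of_lt hq.1 hlt hc.2 le_rfl
    exact ⟨k, hkc, fun x hx => (hk x ⟨hx.1, hx.2.trans_lt hc.2⟩).ne⟩
  · obtain ⟨k, hkq, -, hk⟩ := exists_fn_eq_eqOn_id_of_lt hc.1 hgt hq.2 le_rfl
    exact ⟨k⁻¹, fn_inv_eq_iff.2 hkq, fun x hx hfix =>
      (hk x ⟨hx.1, hx.2.trans_lt hc.2⟩).ne (fn_inv_eq_iff.1 hfix)⟩

theorem exists_eqOn_exists_mem_closure_eqOn_of_fn_ne {f g : HPlusAC a b}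
    (hfg : ∀ x ∈ Ioo a b, f.fn x = x → g.fn x ≠ x) {r : ℝ} (hr : r ∈ Ioo a b) (hfr : f.fn r ≠ r)
    (h : HPlusAC a b) {c d : ℝ} (hc : c ∈ Ioo a b) (hd : d ∈ Ioo a b) :
    ∃ f' g' : HPlusAC a b, EqOn f.fn f'.fn (Icc r b) ∧ EqOn g.fn g'.fn (Icc r b) ∧
      ∃ w ∈ Subgroup.closure {f', g'}, EqOn h.fn w.fn (Icc c d) := by
  obtain ⟨k, hkr, hk⟩ := exists_fn_eq_forall_fn_ne hr (f.mapsTo_fn_Ioo hr) hfr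
  obtain ⟨f', hf'k, hf'f⟩ := exists_eqOn_left_eqOn_right k f ⟨hr.1.le, hr.2.le⟩ hkr
  have hf'r : ∀ x ∈ Ioc a r, f'.fn x ≠ x := fun x hx =>
    (hf'k ⟨hx.1.le, hx.2⟩).trans_ne (hk x hx)
  have hf'g : ∀ x ∈ Ioo a b, f'.fn x = x → g.fn x ≠ x := fun x hx hfix => by
    have hrx : r < x := lt_of_not_ge fun hxr => hf'r x ⟨hx.1, hxr⟩ hfix
    exact hfg x hx ((hf'f ⟨hrx.le, hx.2.le⟩).symm.trans hfix)
  obtain ⟨g', hgg', hw⟩ :=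
    exists_eqOn_exists_mem_closure_eqOn_of_forall_fn_ne hf'g hr hf'r hr h hc hd
  exact ⟨f', g', hf'f.symm, hgg', hw⟩

theorem exists_eqOn_exists_mem_closure_eqOn {f g : HPlusAC a b}
    (hfg : ∀ x ∈ Ioo a b, f.fn x = x → g.fn x ≠ x) {r : ℝ} (hr : r ∈ Ioo a b)
    (h : HPlusAC a b) {c d : ℝ} (hc : c ∈ Ioo a b) (hd : d ∈ Ioo a b) :
    ∃ f' g' : HPlusAC a b, EqOn f.fn f'.fn (Icc r b) ∧ EqOn g.fn g'.fn (Icc r b) ∧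
      ∃ w ∈ Subgroup.closure {f', g'}, EqOn h.fn w.fn (Icc c d) := by
  by_cases hfr : f.fn r = r
  · obtain ⟨g', f', hgg', hff', hw⟩ := exists_eqOn_exists_mem_closure_eqOn_of_fn_ne
      (fun x hx hgx hfx => hfg x hx hfx hgx) hr (hfg r hr hfr) h hc hd
    exact ⟨f', g', hff', hgg', pair_comm g' f' ▸ hw⟩
  · exact exists_eqOn_exists_mem_closure_eqOn_of_fn_ne hfg hr hfr h hc hd

theorem exists_dist_lt_exists_mem_closure_dist_lt (hab : a < b) (f g h : HPlusAC a b) {ε : ℝ}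
    (hε : 0 < ε) :
    ∃ f' g' : HPlusAC a b, dist f f' < ε ∧ dist g g' < ε ∧
      ∃ w ∈ Subgroup.closure {f', g'}, dist h w < ε := by
  obtain ⟨f₁, g₁, hf₁, hg₁, hfg⟩ := exists_dist_lt_forall_not_common_fixed hab f g (half_pos hε)
  obtain ⟨r, hr, _, hs, hf⟩ := exists_forall_eqOn_dist_lt hab f₁ (half_pos hε)
  obtain ⟨r', hr', _, hs', hg⟩ := exists_forall_eqOn_dist_lt hab g₁ (half_pos hε)
  obtain ⟨c, hc, d, hd, hh⟩ := exists_forall_eqOn_dist_lt hab h hε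
  obtain ⟨f', g', hff', hgg', w, hw, hhw⟩ := exists_eqOn_exists_mem_closure_eqOn hfg
    (r := min r r') ⟨lt_min hr.1 hr'.1, min_lt_of_left_lt hr.2⟩ h hc hd
  refine ⟨f', g', ?_, ?_, w, hw, hh w hhw⟩
  · linarith [dist_triangle f f₁ f', hf f' (hff'.mono (Icc_subset_Icc (min_le_left _ _) hs.2.le))]
  · linarith [dist_triangle g g₁ g', hg g' (hgg'.mono (Icc_subset_Icc (min_le_right _ _) hs'.2.le))]

theorem exists_mul_ne_mul (hab : a < b) : ∃ f g : HPlusAC a b, f * g ≠ g * f := by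
  obtain ⟨q, haq, hqb⟩ := exists_between hab
  obtain ⟨d, hqd, hdb⟩ := exists_between hqb
  obtain ⟨c, hqc, hcd⟩ := exists_between hqd
  obtain ⟨f, -, hfd, hf⟩ := exists_fn_eq_eqOn_id_of_lt haq hqc hcd hdb.le
  obtain ⟨g, hgd, -⟩ := exists_fn_eq_eqOn_id_of_lt haq hqd hdb le_rfl
  refine ⟨f, g, fun hcomm => (hf q ⟨haq, hqd⟩).ne ?_⟩
  calc f.fn q = (f * g).fn d := by rw [fn_mul, hgd]
    _ = g.fn (f.fn d) := by rw [hcomm, fn_mul]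
    _ = q := by rw [hfd ⟨le_rfl, hdb.le⟩, id, hgd]

end HPlusAC

section Generation

variable {G : Type*} [Group G] [TopologicalSpace G]

theorem exists_continuous_forall_mem_closure_pair [IsTopologicalGroup G] {p : G × G} {w : G}
    (hw : w ∈ Subgroup.closure {p.1, p.2}) :
    ∃ W : G × G → G, Continuous W ∧ W p = w ∧ ∀ q, W q ∈ Subgroup.closure {q.1, q.2} := by
  induction hw using Subgroup.closure_induction with
  | mem x hx =>
    rcases hx with rfl | rfl
    · exact ⟨Prod.fst, continuous_fst, rfl, fun q =>
        Subgroup.mem_closure_of_mem (mem_insert _ _)⟩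
    · exact ⟨Prod.snd, continuous_snd, rfl, fun q =>
        Subgroup.mem_closure_of_mem (mem_insert_of_mem _ rfl)⟩
  | one => exact ⟨fun _ => 1, continuous_const, rfl, fun _ => one_mem _⟩
  | mul x y _ _ hx hy =>
    obtain ⟨U, hU, rfl, hUmem⟩ := hx
    obtain ⟨V, hV, rfl, hVmem⟩ := hy
    exact ⟨fun q => U q * V q, hU.mul hV, rfl, fun q => mul_mem (hUmem q) (hVmem q)⟩
  | inv x _ hx =>
    obtain ⟨U, hU, rfl, hUmem⟩ := hx
    exact ⟨fun q => (U q)⁻¹, hU.inv, rfl, fun q => inv_mem (hUmem q)⟩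

theorem isOpen_setOf_exists_mem_closure_pair [IsTopologicalGroup G] {U : Set G} (hU : IsOpen U) :
    IsOpen {p : G × G | ∃ w ∈ Subgroup.closure {p.1, p.2}, w ∈ U} := by
  refine isOpen_iff_mem_nhds.2 fun p hp => ?_
  obtain ⟨w, hw, hwU⟩ := hp
  obtain ⟨W, hW, rfl, hWmem⟩ := exists_continuous_forall_mem_closure_pair hw
  filter_upwards [hW.continuousAt.preimage_mem_nhds (hU.mem_nhds hwU)] with q hq
  exact ⟨W q, hWmem q, hq⟩

theorem setOf_dense_closure_pair_eq_biInter [SecondCountableTopology G] :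
    {p : G × G | Dense (Subgroup.closure {p.1, p.2} : Set G)} =
      ⋂ U ∈ TopologicalSpace.countableBasis G,
        {p : G × G | ∃ w ∈ Subgroup.closure {p.1, p.2}, w ∈ U} := by
  ext p
  simp only [mem_ofPred_eq, mem_iInter, (TopologicalSpace.isBasis_countableBasis G).dense_iff]
  refine forall₂_congr fun U hU => ?_
  rw [forall_prop_of_true (TopologicalSpace.nonempty_of_mem_countableBasis hU), inter_comm]
  rfl

theorem isGδ_setOf_dense_closure_pair [IsTopologicalGroup G] [SecondCountableTopology G] :
    IsGδ {p : G × G | Dense (Subgroup.closure {p.1, p.2} : Set G)} := by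
  rw [setOf_dense_closure_pair_eq_biInter]
  exact IsGδ.biInter (TopologicalSpace.countable_countableBasis G) fun U hU =>
    (isOpen_setOf_exists_mem_closure_pair
      (TopologicalSpace.isOpen_of_mem_countableBasis hU)).isGδ

theorem dense_setOf_dense_closure_pair [IsTopologicalGroup G] [SecondCountableTopology G]
    [BaireSpace (G × G)]
    (h : ∀ U : Set G, IsOpen U → U.Nonempty →
      Dense {p : G × G | ∃ w ∈ Subgroup.closure {p.1, p.2}, w ∈ U}) :
    Dense {p : G × G | Dense (Subgroup.closure {p.1, p.2} : Set G)} := by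
  rw [setOf_dense_closure_pair_eq_biInter]
  exact dense_biInter_of_isOpen
    (fun U hU => isOpen_setOf_exists_mem_closure_pair
      (TopologicalSpace.isOpen_of_mem_countableBasis hU))
    (TopologicalSpace.countable_countableBasis G)
    fun U hU => h U (TopologicalSpace.isOpen_of_mem_countableBasis hU)
      (TopologicalSpace.nonempty_of_mem_countableBasis hU)

theorem denseGenerators_two_eq_preimage :
    denseGenerators G 2 = (Homeomorph.finTwoArrow : (Fin 2 → G) ≃ₜ G × G) ⁻¹'
      {p | Dense (Subgroup.closure {p.1, p.2} : Set G)} := by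
  ext g
  have hrange : range g = {g 0, g 1} := by
    ext x
    simp only [mem_range, Fin.exists_fin_two, mem_insert_iff, mem_singleton_iff, eq_comm]
  simp only [denseGenerators, mem_ofPred_eq, mem_preimage, hrange]
  rfl

theorem isGenericallyGenerated_two [IsTopologicalGroup G] [SecondCountableTopology G]
    (h : Dense {p : G × G | Dense (Subgroup.closure {p.1, p.2} : Set G)}) :
    IsGenericallyGenerated G 2 := by
  rw [IsGenericallyGenerated, denseGenerators_two_eq_preimage]
  exact residual_of_dense_Gδ (isGδ_setOf_dense_closure_pair.preimage (Homeomorph.continuous _))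
    (h.preimage (Homeomorph.isOpenMap _))

theorem IsGenericallyGenerated.isTopologicallyGenerated {n : ℕ} [BaireSpace (Fin n → G)]
    (h : IsGenericallyGenerated G n) : IsTopologicallyGenerated G n :=
  (dense_of_mem_residual h).nonempty

theorem IsTopologicallyGenerated.mul_comm [IsTopologicalGroup G] [T2Space G] {n : ℕ}
    (hn : n ≤ 1) (h : IsTopologicallyGenerated G n) (x y : G) : x * y = y * x := by
  obtain ⟨g, hg⟩ := h
  have : Subsingleton (Fin n) := Fin.subsingleton_iff_le_one.2 hn
  have : IsMulCommutative (Subgroup.closure (range g)) :=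
    Subgroup.isMulCommutative_closure <| by
      rintro _ ⟨i, rfl⟩ _ ⟨j, rfl⟩
      rw [Subsingleton.elim i j]
  have hclosed : IsClosed {p : G × G | p.1 * p.2 = p.2 * p.1} :=
    isClosed_eq (by fun_prop) (by fun_prop)
  have hsub : (Subgroup.closure (range g) : Set G) ×ˢ (Subgroup.closure (range g) : Set G) ⊆
      {p : G × G | p.1 * p.2 = p.2 * p.1} := fun p hp => setLike_mul_comm hp.1 hp.2
  exact hclosed.closure_subset_iff.2 hsub (Dense.prod hg hg (x, y))

theorem not_isTopologicallyGenerated_of_mul_ne_mul [IsTopologicalGroup G] [T2Space G] {n : ℕ}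
    (hn : n ≤ 1) {x y : G} (hxy : x * y ≠ y * x) : ¬ IsTopologicallyGenerated G n :=
  fun h => hxy (h.mul_comm hn x y)

theorem two_le_topologicalRank_of_mul_ne_mul [IsTopologicalGroup G] [T2Space G] {x y : G}
    (hxy : x * y ≠ y * x) : 2 ≤ topologicalRank G := by
  refine le_iInf₂ fun n hn => ?_
  have hn' : 2 ≤ n := by
    by_contra hlt
    exact not_isTopologicallyGenerated_of_mul_ne_mul (by lia) hxy hn
  exact_mod_cast hn'

theorem topologicalRank_le_genericRank [∀ n : ℕ, BaireSpace (Fin n → G)] :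
    topologicalRank G ≤ genericRank G :=
  le_iInf₂ fun n hn => iInf₂_le n hn.isTopologicallyGenerated

theorem IsGenericallyGenerated.genericRank_le {n : ℕ} (h : IsGenericallyGenerated G n) :
    genericRank G ≤ n :=
  iInf₂_le n h

end Generation

namespace HPlusAC

variable {a b : ℝ}

theorem dense_setOf_exists_mem_closure_pair (hab : a < b) {U : Set (HPlusAC a b)} (hU : IsOpen U)
    (hne : U.Nonempty) :
    Dense {p : HPlusAC a b × HPlusAC a b | ∃ w ∈ Subgroup.closure {p.1, p.2}, w ∈ U} := by
  obtain ⟨h, hh⟩ := hne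
  obtain ⟨δ, hδ, hball⟩ := Metric.isOpen_iff.1 hU h hh
  refine Metric.dense_iff.2 fun ⟨f, g⟩ ε hε => ?_
  obtain ⟨f', g', hf', hg', w, hw, hwh⟩ :=
    exists_dist_lt_exists_mem_closure_dist_lt hab f g h (lt_min hε hδ)
  refine ⟨(f', g'), ?_, w, hw, hball ?_⟩
  · rw [Metric.mem_ball', Prod.dist_eq]
    exact max_lt (hf'.trans_le (min_le_left _ _)) (hg'.trans_le (min_le_left _ _))
  · exact Metric.mem_ball'.2 (hwh.trans_le (min_le_right _ _))

end HPlusAC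

theorem mainTheorem1 (a b : ℝ) (hab : a < b) :
    IsTopologicalGroup (HPlusAC a b) ∧
    PolishSpace (HPlusAC a b) ∧
    IsGδ {p : HPlusAC a b × HPlusAC a b |
      Dense (Subgroup.closure {p.1, p.2} : Set (HPlusAC a b))} ∧
    Dense {p : HPlusAC a b × HPlusAC a b |
      Dense (Subgroup.closure {p.1, p.2} : Set (HPlusAC a b))} ∧
    IsGenericallyGenerated (HPlusAC a b) 2 ∧
    ¬ IsTopologicallyGenerated (HPlusAC a b) 1 ∧
    topologicalRank (HPlusAC a b) = 2 ∧
    genericRank (HPlusAC a b) = 2 := by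
  have hdense : Dense {p : HPlusAC a b × HPlusAC a b |
      Dense (Subgroup.closure {p.1, p.2} : Set (HPlusAC a b))} :=
    dense_setOf_dense_closure_pair fun _ => HPlusAC.dense_setOf_exists_mem_closure_pair hab
  have hgen : IsGenericallyGenerated (HPlusAC a b) 2 := isGenericallyGenerated_two hdense
  obtain ⟨f, g, hfg⟩ := HPlusAC.exists_mul_ne_mul hab
  have hlower : 2 ≤ topologicalRank (HPlusAC a b) := two_le_topologicalRank_of_mul_ne_mul hfg
  have hupper : genericRank (HPlusAC a b) ≤ 2 := hgen.genericRank_le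
  have hle : topologicalRank (HPlusAC a b) ≤ genericRank (HPlusAC a b) :=
    topologicalRank_le_genericRank
  exact ⟨inferInstance, inferInstance, isGδ_setOf_dense_closure_pair, hdense, hgen,
    not_isTopologicallyGenerated_of_mul_ne_mul le_rfl hfg,
    (hle.trans hupper).antisymm hlower, hupper.antisymm (hlower.trans hle)⟩
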